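/- Let $\mathcal K$ be a differential field of characteristic $0$ with derivation $\partial$, and suppose that $\mathcal K$ is linearly closed: every equation $a_m u^{(m)}+\dots+a_1u'+a_0u=0$ with $m\ge 1$, $a_0,\dots,a_m\in\mathcal K$, $a_m\neq 0$, has a nonzero solution $u\in\mathcal K$. Let $\mathcal K[\partial]$ be the ring of differential operators, $\mathcal K((\partial^{-1}))$ the skewfield of pseudodifferential operators, and $\mathcal K(\partial)$ the subskewfield of $\mathcal K((\partial^{-1}))$ generated by $\mathcal K[\partial]$. For $n\ge 0$ and $A\in M_n(\mathcal K[\partial])$ let $\ker A=\{f\in\mathcal K^n : A(\partial)f=0\}$. Let $\det A=\det_1(A)\lambda^{d(A)}$ be the Dieudonné determinant, i.e. the unique multiplicative function on $M_n(\mathcal K((\partial^{-1})))$ whose value on an upper triangular matrix is the product of the leading terms $a\lambda^{m}$ of its diagonal entries $a\partial^m+(\text{lower order terms})$, $a\ne0$ (and $0$ if a diagonal entry is $0$). $A$ is called non-degenerate if $\det A\neq0$. A right fractional decomposition of $H\in M_n(\mathcal K(\partial))$ is an expression $H=AB^{-1}$ with $A,B\in M_n(\mathcal K[\partial])$ and $B$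 non-degenerate. Then: (a) Every $H\in M_n(\mathcal K(\partial))$ has a right fractional decomposition $H=AB^{-1}$ with $\ker A\cap\ker B=0$. (b) For every right fractional decomposition $H=AB^{-1}$ of a matrix $H\in M_n(\mathcal K(\partial))$ the following conditions are equivalent: (i) $d(B)$ is minimal among all right fractional decompositions of $H$; (ii) $A$ and $B$ are coprime, i.e. if $A=A_1D$ and $B=B_1D$ with $A_1,B_1,D\in M_n(\mathcal K[\partial])$, then $D$ is invertible in $M_n(\mathcal K[\partial])$; (iii) $\ker A\cap\ker B=0$. A right fractional decomposition that satisfies these conditions is called minimal. (c) If $H=A_0B_0^{-1}$ is a minimal fractional decomposition and $H=AB^{-1}$ is any right fractional decomposition of the same $H$, then there is $D\in M_n(\mathcal K[\partial])$ with $A=A_0D$ and $B=B_0D$. -/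

import Mathlib

/-! ## Pseudodifferential operators over a differential field -/

/-- A formal pseudodifferential operator `∑ aₘ ∂ᵐ` over a differential field `K`, i.e. an element
of `K((∂⁻¹))`: a family of coefficients, indexed by `ℤ`, that vanish for all large indices. -/
@[ext]
structure PseudoDiffOp (K : Type*) [Field K] where
  /-- The coefficient of `∂ᵐ`, written to the left of `∂ᵐ`. -/
  coeff : ℤ → K
  bounded : ∃ N : ℤ, ∀ m, N < m → coeff m = 0

namespace PseudoDiffOp

variable {K : Type*} [Field K] [Differential K]

/-- The `k`-th derivative of `x`. -/
def iterDeriv (k : ℕ) (x : K) : K := (⇑(Differential.deriv : Derivation ℤ K K))^[k] x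

/-- The coefficient of `∂^(m + n - s)` in the product `a ∂ᵐ ∘ b ∂ⁿ`: it is
`binom(m, s) a b⁽ˢ⁾` for `s ≥ 0`, and `0` for `s < 0`. -/
noncomputable def mulTerm (m s : ℤ) (a b : K) : K :=
  if 0 ≤ s then ((Ring.choose m s.toNat : ℤ) : K) * (a * iterDeriv s.toNat b) else 0

lemma iterDeriv_add (k : ℕ) (x y : K) : iterDeriv k (x + y) = iterDeriv k x + iterDeriv k y := by
  simp only [iterDeriv]
  exact iterate_map_add (Differential.deriv : Derivation ℤ K K) k x y

@[simp] lemma iterDeriv_zero_right (k : ℕ) : iterDeriv k (0 : K) = 0 := by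
  simp only [iterDeriv]
  exact iterate_map_zero (Differential.deriv : Derivation ℤ K K) k

@[simp] lemma iterDeriv_zero (x : K) : iterDeriv 0 x = x := rfl

lemma iterDeriv_succ (k : ℕ) (x : K) :
    iterDeriv (k + 1) x = (Differential.deriv : Derivation ℤ K K) (iterDeriv k x) := by
  simp only [iterDeriv]
  exact Function.iterate_succ_apply' _ _ _

lemma iterDeriv_iterDeriv (k l : ℕ) (x : K) :
    iterDeriv k (iterDeriv l x) = iterDeriv (k + l) x := by
  simp only [iterDeriv, Function.iterate_add_apply]

lemma iterDeriv_intCast_mul (k : ℕ) (c : ℤ) (x : K) :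
    iterDeriv k ((c : K) * x) = (c : K) * iterDeriv k x := by
  induction k with
  | zero => rfl
  | succ k ih => rw [iterDeriv_succ, ih, iterDeriv_succ]; simp

lemma iterDeriv_one (k : ℕ) (hk : k ≠ 0) : iterDeriv k (1 : K) = 0 := by
  obtain ⟨j, rfl⟩ := Nat.exists_eq_succ_of_ne_zero hk
  induction j with
  | zero => simp [iterDeriv]
  | succ j ih => rw [Nat.succ_eq_add_one, iterDeriv_succ, ih (by simp)]; simp

lemma iterDeriv_mul (k : ℕ) (x y : K) :
    iterDeriv k (x * y) = ∑ ij ∈ Finset.HasAntidiagonal.antidiagonal k,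
      (Nat.choose k ij.1 : K) * (iterDeriv ij.1 x * iterDeriv ij.2 y) := by
  induction k with
  | zero => simp
  | succ k ih =>
    rw [Finset.sum_antidiagonal_choose_succ_mul (fun i j => iterDeriv i x * iterDeriv j y),
      iterDeriv_succ, ih, map_sum, ← Finset.sum_add_distrib]
    refine Finset.sum_congr rfl fun ij hij => ?_
    rw [Finset.HasAntidiagonal.mem_antidiagonal] at hij
    have hc : (k.choose ij.2) = k.choose ij.1 := by
      rw [← hij]; exact (Nat.choose_symm_add).symm
    rw [hc]
    simp only [iterDeriv_succ, Derivation.leibniz, smul_eq_mul, Derivation.map_natCast]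
    ring

lemma iterDeriv_sum {ι : Type*} (s : Finset ι) (f : ι → K) (k : ℕ) :
    iterDeriv k (∑ i ∈ s, f i) = ∑ i ∈ s, iterDeriv k (f i) := by
  classical
  induction s using Finset.induction_on with
  | empty => simp
  | insert a s ha ih => rw [Finset.sum_insert ha, Finset.sum_insert ha, iterDeriv_add, ih]

@[simp] lemma mulTerm_zero_left (m s : ℤ) (b : K) : mulTerm m s 0 b = 0 := by simp [mulTerm]
@[simp] lemma mulTerm_zero_right (m s : ℤ) (a : K) : mulTerm m s a 0 = 0 := by simp [mulTerm]

lemma mulTerm_of_neg {m s : ℤ} (h : s < 0) (a b : K) : mulTerm m s a b = 0 := by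
  simp [mulTerm, not_le.mpr h]

lemma mulTerm_natCast (m : ℤ) (k : ℕ) (a b : K) :
    mulTerm m k a b = ((Ring.choose m k : ℤ) : K) * (a * iterDeriv k b) := by
  simp [mulTerm]

lemma mulTerm_add_left (m s : ℤ) (a a' b : K) :
    mulTerm m s (a + a') b = mulTerm m s a b + mulTerm m s a' b := by
  unfold mulTerm; split_ifs <;> ring

lemma mulTerm_add_right (m s : ℤ) (a b b' : K) :
    mulTerm m s a (b + b') = mulTerm m s a b + mulTerm m s a b' := by
  unfold mulTerm; rw [iterDeriv_add]; split_ifs <;> ring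

lemma mulTerm_sum_left {ι : Type*} (t : Finset ι) (f : ι → K) (m s : ℤ) (b : K) :
    mulTerm m s (∑ i ∈ t, f i) b = ∑ i ∈ t, mulTerm m s (f i) b := by
  unfold mulTerm; split_ifs
  · rw [Finset.sum_mul, Finset.mul_sum]
  · simp

lemma mulTerm_sum_right {ι : Type*} (t : Finset ι) (f : ι → K) (m s : ℤ) (a : K) :
    mulTerm m s a (∑ i ∈ t, f i) = ∑ i ∈ t, mulTerm m s a (f i) := by
  unfold mulTerm; split_ifs
  · rw [iterDeriv_sum, Finset.mul_sum, Finset.mul_sum]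
  · simp

lemma mulTerm_assoc_nat (m n : ℤ) (a b c : K) (s : ℕ) :
    ∑ il ∈ Finset.HasAntidiagonal.antidiagonal s, mulTerm (m + n - il.1) il.2 (mulTerm m il.1 a b) c =
    ∑ kl ∈ Finset.HasAntidiagonal.antidiagonal s, mulTerm m kl.1 a (mulTerm n kl.2 b c) := by
  simp only [mulTerm_natCast, iterDeriv_intCast_mul]
  simp only [iterDeriv_mul, iterDeriv_iterDeriv]
  have key : ∀ (i l : ℕ), ((Ring.choose (m + n - i) l : ℤ) : K) =
      ∑ jl ∈ Finset.HasAntidiagonal.antidiagonal l,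
        ((Ring.choose (m - i) jl.1 : ℤ) : K) * ((Ring.choose n jl.2 : ℤ) : K) := by
    intro i l
    rw [show m + n - (i : ℤ) = (m - i) + n by ring, Ring.add_choose_eq l (Commute.all _ _)]
    push_cast; rfl
  have hch : ∀ i j : ℕ, ((Ring.choose m (i + j) : ℤ) : K) * ((i + j).choose i : K) =
      ((Ring.choose m i : ℤ) : K) * ((Ring.choose (m - i) j : ℤ) : K) := by
    intro i j
    have := Ring.choose_smul_choose m (Nat.le_add_right i j)
    rw [Nat.add_sub_cancel_left, nsmul_eq_mul] at this
    have h2 := congrArg (Int.cast : ℤ → K) this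
    push_cast at h2
    rw [← h2]; ring
  simp only [key, Finset.sum_mul, Finset.mul_sum]
  rw [Finset.sum_sigma', Finset.sum_sigma']
  symm
  refine Finset.sum_nbij' (fun x => ⟨(x.2.1, x.2.2 + x.1.2), (x.2.2, x.1.2)⟩)
    (fun x => ⟨(x.1.1 + x.2.1, x.2.2), (x.1.1, x.2.1)⟩) ?_ ?_ ?_ ?_ ?_
  · rintro ⟨⟨k, l⟩, ⟨i, j⟩⟩ h
    simp only [Finset.mem_sigma, Finset.HasAntidiagonal.mem_antidiagonal] at h ⊢
    obtain ⟨h1, h2⟩ := h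
    constructor
    · rw [← h1, ← h2]; ring
    · trivial
  · rintro ⟨⟨k, l⟩, ⟨i, j⟩⟩ h
    simp only [Finset.mem_sigma, Finset.HasAntidiagonal.mem_antidiagonal] at h ⊢
    obtain ⟨h1, h2⟩ := h
    constructor
    · rw [← h1, ← h2]; ring
    · trivial
  · rintro ⟨⟨k, l⟩, ⟨i, j⟩⟩ h
    simp only [Finset.mem_sigma, Finset.HasAntidiagonal.mem_antidiagonal] at h
    obtain ⟨h1, rfl⟩ := h
    rfl
  · rintro ⟨⟨k, l⟩, ⟨i, j⟩⟩ h
    simp only [Finset.mem_sigma, Finset.HasAntidiagonal.mem_antidiagonal] at h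
    obtain ⟨h1, rfl⟩ := h
    rfl
  · rintro ⟨⟨k, l⟩, ⟨i, j⟩⟩ h
    simp only [Finset.mem_sigma, Finset.HasAntidiagonal.mem_antidiagonal] at h
    obtain ⟨h1, rfl⟩ := h
    simp only
    linear_combination (a * iterDeriv i b * iterDeriv (j + l) c *
      ((Ring.choose n l : ℤ) : K)) * hch i j

/-- The product on `K((∂⁻¹))`, determined by `∂ᵐ ∘ b = ∑_{k ≥ 0} binom(m, k) b⁽ᵏ⁾ ∂^(m - k)`. -/
noncomputable def mulCoeff (P Q : PseudoDiffOp K) (r : ℤ) : K :=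
  ∑ᶠ p : ℤ × ℤ, mulTerm p.1 (p.1 + p.2 - r) (P.coeff p.1) (Q.coeff p.2)

lemma mulCoeff_eq_sum (P Q : PseudoDiffOp K) {N₁ N₂ : ℤ} (hP : ∀ m, N₁ < m → P.coeff m = 0)
    (hQ : ∀ m, N₂ < m → Q.coeff m = 0) {M r : ℤ} (h1 : N₁ ≤ M) (h2 : N₂ ≤ M)
    (h3 : N₁ - r ≤ M) (h4 : N₂ - r ≤ M) :
    mulCoeff P Q r = ∑ m ∈ Finset.Icc (-M) M, ∑ n ∈ Finset.Icc (-M) M,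
      mulTerm m (m + n - r) (P.coeff m) (Q.coeff n) := by
  rw [← Finset.sum_product', mulCoeff]
  apply finsum_eq_sum_of_support_subset
  rintro ⟨m, n⟩ h
  rw [Function.mem_support] at h
  simp only [Finset.coe_product, Set.mem_prod, Finset.coe_Icc, Set.mem_Icc]
  have hm : m ≤ N₁ := by
    by_contra hc; exact h (by simp [hP m (not_le.mp hc)])
  have hn : n ≤ N₂ := by
    by_contra hc; exact h (by simp [hQ n (not_le.mp hc)])
  have hs : 0 ≤ m + n - r := by
    by_contra hc; exact h (mulTerm_of_neg (not_le.mp hc) _ _)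
  omega

lemma mulCoeff_eq_zero (P Q : PseudoDiffOp K) {N₁ N₂ : ℤ} (hP : ∀ m, N₁ < m → P.coeff m = 0)
    (hQ : ∀ m, N₂ < m → Q.coeff m = 0) {r : ℤ} (hr : N₁ + N₂ < r) : mulCoeff P Q r = 0 := by
  rw [mulCoeff]
  refine finsum_eq_zero_of_forall_eq_zero ?_
  rintro ⟨m, n⟩
  by_cases hm : N₁ < m
  · simp [hP m hm]
  by_cases hn : N₂ < n
  · simp [hQ n hn]
  exact mulTerm_of_neg (by simp only; omega) _ _

lemma exists_bound (P : PseudoDiffOp K) : ∃ N : ℤ, 0 ≤ N ∧ ∀ m, N < m → P.coeff m = 0 := by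
  obtain ⟨N, hN⟩ := P.bounded
  exact ⟨max N 0, le_max_right _ _, fun m hm => hN m (lt_of_le_of_lt (le_max_left _ _) hm)⟩

noncomputable instance : Mul (PseudoDiffOp K) where
  mul P Q := ⟨mulCoeff P Q, by
    obtain ⟨N₁, hP⟩ := P.bounded
    obtain ⟨N₂, hQ⟩ := Q.bounded
    exact ⟨N₁ + N₂, fun m hm => mulCoeff_eq_zero P Q hP hQ hm⟩⟩

instance : Zero (PseudoDiffOp K) := ⟨⟨fun _ => 0, 0, fun _ _ => rfl⟩⟩

instance : Add (PseudoDiffOp K) where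
  add P Q := ⟨fun m => P.coeff m + Q.coeff m, by
    obtain ⟨N₁, _, hP⟩ := P.exists_bound
    obtain ⟨N₂, _, hQ⟩ := Q.exists_bound
    exact ⟨N₁ + N₂, fun m hm => by rw [hP m (by omega), hQ m (by omega), add_zero]⟩⟩

instance : Neg (PseudoDiffOp K) where
  neg P := ⟨fun m => - P.coeff m, by
    obtain ⟨N, hN⟩ := P.bounded
    exact ⟨N, fun m hm => by rw [hN m hm, neg_zero]⟩⟩

/-- The operator `a ∂ᵐ`. -/
def monomial (m : ℤ) (a : K) : PseudoDiffOp K where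
  coeff := fun k => if k = m then a else 0
  bounded := ⟨m, fun _ hk => if_neg hk.ne'⟩

instance : One (PseudoDiffOp K) := ⟨monomial 0 1⟩

@[simp] lemma coeff_zero (m : ℤ) : (0 : PseudoDiffOp K).coeff m = 0 := rfl
@[simp] lemma coeff_add (P Q : PseudoDiffOp K) (m : ℤ) :
    (P + Q).coeff m = P.coeff m + Q.coeff m := rfl
@[simp] lemma coeff_neg (P : PseudoDiffOp K) (m : ℤ) : (-P).coeff m = -P.coeff m := rfl
lemma coeff_one (m : ℤ) : (1 : PseudoDiffOp K).coeff m = if m = 0 then 1 else 0 := rfl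
lemma coeff_mul (P Q : PseudoDiffOp K) (r : ℤ) : (P * Q).coeff r = mulCoeff P Q r := rfl

lemma mulTerm_assoc (m n j r M : ℤ) (a b c : K) (h1 : m + n ≤ M) (h2 : -M ≤ r - j)
    (h3 : -M ≤ r - m) (h4 : n + j ≤ M) :
    ∑ t ∈ Finset.Icc (-M) M, mulTerm t (t + j - r) (mulTerm m (m + n - t) a b) c =
    ∑ t ∈ Finset.Icc (-M) M, mulTerm m (m + t - r) a (mulTerm n (n + j - t) b c) := by
  by_cases hs : 0 ≤ m + n + j - r
  · obtain ⟨s, hs⟩ := Int.eq_ofNat_of_zero_le hs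
    have := mulTerm_assoc_nat m n a b c s
    have e1 : ∑ t ∈ Finset.Icc (-M) M, mulTerm t (t + j - r) (mulTerm m (m + n - t) a b) c =
        ∑ il ∈ Finset.HasAntidiagonal.antidiagonal s, mulTerm (m + n - il.1) il.2 (mulTerm m il.1 a b) c := by
      symm
      refine Finset.sum_of_injOn (fun il => m + n - il.1) ?_ ?_ ?_ ?_
      · rintro ⟨i, l⟩ h ⟨i', l'⟩ h' e
        simp only [Finset.mem_coe,
          Finset.HasAntidiagonal.mem_antidiagonal] at h h' e
        ext <;> simp only <;> omega
      · rintro ⟨i, l⟩ h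
        simp only [Finset.mem_coe, Finset.HasAntidiagonal.mem_antidiagonal] at h
        simp only [Finset.coe_Icc, Set.mem_Icc]
        omega
      · intro t _ ht'
        by_cases h0 : m + n - t < 0
        · rw [mulTerm_of_neg h0]; simp
        by_cases h0' : t + j - r < 0
        · rw [mulTerm_of_neg h0']
        refine absurd ⟨((m + n - t).toNat, (t + j - r).toNat), ?_, ?_⟩ ht'
        · simp only [Finset.mem_coe, Finset.HasAntidiagonal.mem_antidiagonal]; omega
        · simp only; omega
      · rintro ⟨i, l⟩ h
        simp only [Finset.HasAntidiagonal.mem_antidiagonal] at h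
        simp only
        rw [show m + n - (i : ℤ) + j - r = l by omega,
          show m + n - (m + n - (i : ℤ)) = i by omega]
    have e2 : ∑ t ∈ Finset.Icc (-M) M, mulTerm m (m + t - r) a (mulTerm n (n + j - t) b c) =
        ∑ kl ∈ Finset.HasAntidiagonal.antidiagonal s, mulTerm m kl.1 a (mulTerm n kl.2 b c) := by
      symm
      refine Finset.sum_of_injOn (fun kl => r - m + kl.1) ?_ ?_ ?_ ?_
      · rintro ⟨i, l⟩ h ⟨i', l'⟩ h' e
        simp only [Finset.mem_coe, Finset.HasAntidiagonal.mem_antidiagonal] at h h' e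
        ext <;> simp only <;> omega
      · rintro ⟨i, l⟩ h
        simp only [Finset.mem_coe, Finset.HasAntidiagonal.mem_antidiagonal] at h
        simp only [Finset.coe_Icc, Set.mem_Icc]
        omega
      · intro t _ ht'
        by_cases h0 : n + j - t < 0
        · rw [mulTerm_of_neg h0]; simp
        by_cases h0' : m + t - r < 0
        · rw [mulTerm_of_neg h0']
        refine absurd ⟨((m + t - r).toNat, (n + j - t).toNat), ?_, ?_⟩ ht'
        · simp only [Finset.mem_coe, Finset.HasAntidiagonal.mem_antidiagonal]; omega
        · simp only; omega
      · rintro ⟨i, l⟩ h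
        simp only [Finset.HasAntidiagonal.mem_antidiagonal] at h
        simp only
        rw [show m + (r - m + (i : ℤ)) - r = i by omega,
          show n + j - (r - m + (i : ℤ)) = l by omega]
    rw [e1, e2, this]
  · rw [Finset.sum_eq_zero, Finset.sum_eq_zero]
    · intro t _
      by_cases h0 : n + j - t < 0
      · rw [mulTerm_of_neg h0]; simp
      · rw [mulTerm_of_neg (by omega)]
    · intro t _
      by_cases h0 : t + j - r < 0
      · rw [mulTerm_of_neg h0]
      · rw [mulTerm_of_neg (show m + n - t < 0 by omega)]; simp

protected lemma mul_assoc (P Q R : PseudoDiffOp K) : P * Q * R = P * (Q * R) := by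
  obtain ⟨N₁, hN₁, hP⟩ := P.exists_bound
  obtain ⟨N₂, hN₂, hQ⟩ := Q.exists_bound
  obtain ⟨N₃, hN₃, hR⟩ := R.exists_bound
  ext r
  obtain ⟨M, hM⟩ : ∃ M : ℤ, M = N₁ + N₂ + N₃ + |r| := ⟨_, rfl⟩
  have hr1 := le_abs_self r
  have hr2 := neg_abs_le r
  have hPQ : ∀ m, N₁ + N₂ < m → (P * Q).coeff m = 0 :=
    fun m hm => mulCoeff_eq_zero P Q hP hQ hm
  have hQR : ∀ m, N₂ + N₃ < m → (Q * R).coeff m = 0 :=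
    fun m hm => mulCoeff_eq_zero Q R hQ hR hm
  rw [coeff_mul, coeff_mul,
    mulCoeff_eq_sum (P * Q) R hPQ hR (M := M) (r := r) (by omega) (by omega) (by omega) (by omega),
    mulCoeff_eq_sum P (Q * R) hP hQR (M := M) (r := r) (by omega) (by omega) (by omega) (by omega)]
  have L : ∑ t ∈ Finset.Icc (-M) M, ∑ j ∈ Finset.Icc (-M) M,
      mulTerm t (t + j - r) ((P * Q).coeff t) (R.coeff j) =
      ∑ t ∈ Finset.Icc (-M) M, ∑ j ∈ Finset.Icc (-M) M, ∑ m ∈ Finset.Icc (-M) M,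
        ∑ n ∈ Finset.Icc (-M) M, mulTerm t (t + j - r)
          (mulTerm m (m + n - t) (P.coeff m) (Q.coeff n)) (R.coeff j) := by
    refine Finset.sum_congr rfl fun t _ => Finset.sum_congr rfl fun j _ => ?_
    by_cases hj : N₃ < j
    · simp [hR j hj]
    by_cases ht : t + j - r < 0
    · simp [mulTerm_of_neg ht]
    · rw [coeff_mul, mulCoeff_eq_sum P Q hP hQ (M := M) (by omega) (by omega) (by omega)
        (by omega)]
      simp only [mulTerm_sum_left]
  have R' : ∑ m ∈ Finset.Icc (-M) M, ∑ t ∈ Finset.Icc (-M) M,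
      mulTerm m (m + t - r) (P.coeff m) ((Q * R).coeff t) =
      ∑ m ∈ Finset.Icc (-M) M, ∑ t ∈ Finset.Icc (-M) M, ∑ n ∈ Finset.Icc (-M) M,
        ∑ j ∈ Finset.Icc (-M) M, mulTerm m (m + t - r) (P.coeff m)
          (mulTerm n (n + j - t) (Q.coeff n) (R.coeff j)) := by
    refine Finset.sum_congr rfl fun m _ => Finset.sum_congr rfl fun t _ => ?_
    by_cases hm : N₁ < m
    · simp [hP m hm]
    by_cases ht : m + t - r < 0
    · simp [mulTerm_of_neg ht]
    · rw [coeff_mul, mulCoeff_eq_sum Q R hQ hR (M := M) (by omega) (by omega) (by omega)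
        (by omega)]
      simp only [mulTerm_sum_right]
  rw [L, R']
  have LL : ∑ t ∈ Finset.Icc (-M) M, ∑ j ∈ Finset.Icc (-M) M, ∑ m ∈ Finset.Icc (-M) M,
        ∑ n ∈ Finset.Icc (-M) M, mulTerm t (t + j - r)
          (mulTerm m (m + n - t) (P.coeff m) (Q.coeff n)) (R.coeff j) =
      ∑ m ∈ Finset.Icc (-M) M, ∑ n ∈ Finset.Icc (-M) M, ∑ j ∈ Finset.Icc (-M) M,
        ∑ t ∈ Finset.Icc (-M) M, mulTerm t (t + j - r)
          (mulTerm m (m + n - t) (P.coeff m) (Q.coeff n)) (R.coeff j) := by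
    simp only [← Finset.sum_product']
    refine Finset.sum_nbij' (fun x => (x.2.2.1, x.2.2.2, x.2.1, x.1))
      (fun x => (x.2.2.2, x.2.2.1, x.1, x.2.1)) ?_ ?_ ?_ ?_ ?_ <;>
      simp +contextual
  have RR : ∑ m ∈ Finset.Icc (-M) M, ∑ t ∈ Finset.Icc (-M) M, ∑ n ∈ Finset.Icc (-M) M,
        ∑ j ∈ Finset.Icc (-M) M, mulTerm m (m + t - r) (P.coeff m)
          (mulTerm n (n + j - t) (Q.coeff n) (R.coeff j)) =
      ∑ m ∈ Finset.Icc (-M) M, ∑ n ∈ Finset.Icc (-M) M, ∑ j ∈ Finset.Icc (-M) M,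
        ∑ t ∈ Finset.Icc (-M) M, mulTerm m (m + t - r) (P.coeff m)
          (mulTerm n (n + j - t) (Q.coeff n) (R.coeff j)) := by
    simp only [← Finset.sum_product']
    refine Finset.sum_nbij' (fun x => (x.1, x.2.2.1, x.2.2.2, x.2.1))
      (fun x => (x.1, x.2.2.2, x.2.1, x.2.2.1)) ?_ ?_ ?_ ?_ ?_ <;>
      simp +contextual
  rw [LL, RR]
  refine Finset.sum_congr rfl fun m _ => Finset.sum_congr rfl fun n _ =>
    Finset.sum_congr rfl fun j _ => ?_
  by_cases hm : N₁ < m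
  · simp [hP m hm]
  by_cases hn : N₂ < n
  · simp [hQ n hn]
  by_cases hj : N₃ < j
  · simp [hR j hj]
  exact mulTerm_assoc m n j r M _ _ _ (by omega) (by omega) (by omega) (by omega)

lemma monomial_zero_mul_coeff (a : K) (P : PseudoDiffOp K) (r : ℤ) :
    (monomial 0 a * P).coeff r = a * P.coeff r := by
  rw [coeff_mul, mulCoeff, finsum_eq_single _ (0, r)]
  · simp [monomial, mulTerm]
  · rintro ⟨m, n⟩ h
    simp only [monomial]
    split_ifs with hm
    · subst hm
      have hn : n ≠ r := fun hn => h (by rw [hn])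
      rcases lt_or_gt_of_ne hn with h' | h'
      · exact mulTerm_of_neg (by omega) _ _
      · obtain ⟨s, hs⟩ := Int.eq_ofNat_of_zero_le (show 0 ≤ 0 + n - r by omega)
        rw [hs, mulTerm_natCast, Ring.choose_zero_pos ℤ (by omega)]; simp
    · simp

protected lemma mul_one (P : PseudoDiffOp K) : P * 1 = P := by
  ext r
  rw [coeff_mul, mulCoeff, finsum_eq_single _ (r, 0)]
  · simp [coeff_one, mulTerm]
  · rintro ⟨m, n⟩ h
    simp only [coeff_one]
    split_ifs with hn
    · subst hn
      have hm : m ≠ r := fun hn => h (by rw [hn])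
      rcases lt_or_gt_of_ne hm with h' | h'
      · exact mulTerm_of_neg (by omega) _ _
      · obtain ⟨s, hs⟩ := Int.eq_ofNat_of_zero_le (show 0 ≤ m + 0 - r by omega)
        rw [hs, mulTerm_natCast, iterDeriv_one _ (by omega)]; simp
    · simp

protected lemma mul_add (P Q R : PseudoDiffOp K) : P * (Q + R) = P * Q + P * R := by
  obtain ⟨N₁, hN₁, hP⟩ := P.exists_bound
  obtain ⟨N₂, hN₂, hQ⟩ := Q.exists_bound
  obtain ⟨N₃, hN₃, hR⟩ := R.exists_bound
  ext r
  obtain ⟨M, hM⟩ : ∃ M : ℤ, M = N₁ + N₂ + N₃ + |r| := ⟨_, rfl⟩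
  have hr1 := le_abs_self r
  have hr2 := neg_abs_le r
  have hQR : ∀ m, N₂ + N₃ < m → (Q + R).coeff m = 0 := fun m hm => by
    rw [coeff_add, hQ m (by omega), hR m (by omega), add_zero]
  rw [coeff_add, coeff_mul, coeff_mul, coeff_mul,
    mulCoeff_eq_sum P (Q + R) hP hQR (M := M) (by omega) (by omega) (by omega) (by omega),
    mulCoeff_eq_sum P Q hP hQ (M := M) (by omega) (by omega) (by omega) (by omega),
    mulCoeff_eq_sum P R hP hR (M := M) (by omega) (by omega) (by omega) (by omega)]
  simp only [coeff_add, mulTerm_add_right, Finset.sum_add_distrib]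

protected lemma add_mul (P Q R : PseudoDiffOp K) : (P + Q) * R = P * R + Q * R := by
  obtain ⟨N₁, hN₁, hP⟩ := P.exists_bound
  obtain ⟨N₂, hN₂, hQ⟩ := Q.exists_bound
  obtain ⟨N₃, hN₃, hR⟩ := R.exists_bound
  ext r
  obtain ⟨M, hM⟩ : ∃ M : ℤ, M = N₁ + N₂ + N₃ + |r| := ⟨_, rfl⟩
  have hr1 := le_abs_self r
  have hr2 := neg_abs_le r
  have hPQ : ∀ m, N₁ + N₂ < m → (P + Q).coeff m = 0 := fun m hm => by
    rw [coeff_add, hP m (by omega), hQ m (by omega), add_zero]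
  rw [coeff_add, coeff_mul, coeff_mul, coeff_mul,
    mulCoeff_eq_sum (P + Q) R hPQ hR (M := M) (by omega) (by omega) (by omega) (by omega),
    mulCoeff_eq_sum P R hP hR (M := M) (by omega) (by omega) (by omega) (by omega),
    mulCoeff_eq_sum Q R hQ hR (M := M) (by omega) (by omega) (by omega) (by omega)]
  simp only [coeff_add, mulTerm_add_left, Finset.sum_add_distrib]

/-- The ring `K((∂⁻¹))` of pseudodifferential operators. -/
noncomputable instance : Ring (PseudoDiffOp K) :=
  Ring.ofMinimalAxioms
    (fun P Q R => by ext; simp [add_assoc])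
    (fun P => by ext; simp)
    (fun P => by ext; simp)
    PseudoDiffOp.mul_assoc
    (fun P => by
      ext r
      exact (monomial_zero_mul_coeff 1 P r).trans (one_mul _))
    PseudoDiffOp.mul_one
    PseudoDiffOp.mul_add
    PseudoDiffOp.add_mul

end PseudoDiffOp

namespace PseudoDiffOp

variable {K : Type*} [Field K] [Differential K]

lemma exists_top (P : PseudoDiffOp K) (hP : P ≠ 0) :
    ∃ d : ℤ, P.coeff d ≠ 0 ∧ ∀ m, d < m → P.coeff m = 0 := by
  obtain ⟨N, hN⟩ := P.bounded
  have hne : ∃ m, P.coeff m ≠ 0 := by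
    by_contra hc
    push Not at hc
    exact hP (by ext m; exact hc m)
  obtain ⟨d, hd, hmax⟩ := Int.exists_greatest_of_bdd (P := fun m => P.coeff m ≠ 0)
    ⟨N, fun m hm => not_lt.mp fun h => hm (hN m h)⟩ hne
  exact ⟨d, hd, fun m hm => by_contra fun hc => absurd (hmax m hc) (not_le.mpr hm)⟩

/-- The order of a nonzero pseudodifferential operator, i.e. the largest exponent `m` such that
the coefficient of `∂ᵐ` is nonzero (and `0` for the zero operator). -/
noncomputable def order (P : PseudoDiffOp K) : ℤ :=
  open Classical in if h : P = 0 then 0 else (P.exists_top h).choose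

/-- The coefficient of the highest power of `∂`. -/
noncomputable def leadingCoeff (P : PseudoDiffOp K) : K := P.coeff P.order

lemma leadingCoeff_ne_zero {P : PseudoDiffOp K} (hP : P ≠ 0) : P.leadingCoeff ≠ 0 := by
  rw [leadingCoeff, order, dif_neg hP]
  exact (P.exists_top hP).choose_spec.1

lemma coeff_eq_zero_of_order_lt {P : PseudoDiffOp K} {m : ℤ} (hm : P.order < m) :
    P.coeff m = 0 := by
  by_cases hP : P = 0
  · rw [hP]; rfl
  · rw [order, dif_neg hP] at hm
    exact (P.exists_top hP).choose_spec.2 m hm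

lemma order_eq {P : PseudoDiffOp K} {d : ℤ} (h1 : P.coeff d ≠ 0)
    (h2 : ∀ m, d < m → P.coeff m = 0) : P.order = d := by
  have hP : P ≠ 0 := by rintro rfl; exact h1 rfl
  apply le_antisymm
  · by_contra hc
    exact leadingCoeff_ne_zero hP (h2 _ (not_le.mp hc))
  · by_contra hc
    exact h1 (coeff_eq_zero_of_order_lt (not_le.mp hc))

lemma mul_coeff_top (P Q : PseudoDiffOp K) {d e : ℤ} (hP : ∀ m, d < m → P.coeff m = 0)
    (hQ : ∀ m, e < m → Q.coeff m = 0) : (P * Q).coeff (d + e) = P.coeff d * Q.coeff e := by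
  rw [coeff_mul, mulCoeff, finsum_eq_single _ (d, e)]
  · simp [mulTerm]
  · rintro ⟨m, n⟩ h
    by_cases hm : d < m
    · simp [hP m hm]
    by_cases hn : e < n
    · simp [hQ n hn]
    refine mulTerm_of_neg ?_ _ _
    simp only
    by_contra hc
    exact h (by rw [show m = d by omega, show n = e by omega])

lemma mul_coeff_congr (P : PseudoDiffOp K) {Q Q' : PseudoDiffOp K} {d r : ℤ}
    (hP : ∀ m, d < m → P.coeff m = 0) (hQ : ∀ n, r - d ≤ n → Q.coeff n = Q'.coeff n) :
    (P * Q).coeff r = (P * Q').coeff r := by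
  rw [coeff_mul, coeff_mul, mulCoeff, mulCoeff]
  refine finsum_congr ?_
  rintro ⟨m, n⟩
  by_cases hm : d < m
  · simp [hP m hm]
  by_cases hn : r - d ≤ n
  · simp only [hQ n hn]
  · rw [mulTerm_of_neg (by simp only; omega), mulTerm_of_neg (by simp only; omega)]

/-- Successive approximations to a right inverse. -/
noncomputable def approxInv (P : PseudoDiffOp K) : ℕ → PseudoDiffOp K
  | 0 => 0
  | k + 1 => approxInv P k + monomial (-P.order - k)
      (P.leadingCoeff⁻¹ * ((1 : PseudoDiffOp K).coeff (-k) - (P * approxInv P k).coeff (-k)))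

lemma approxInv_coeff_stable (P : PseudoDiffOp K) {k l : ℕ} (h : k ≤ l) {n : ℤ}
    (hn : -P.order - k < n) : (approxInv P l).coeff n = (approxInv P k).coeff n := by
  induction l, h using Nat.le_induction with
  | base => rfl
  | succ l hl ih =>
    rw [approxInv, coeff_add, ih, monomial]
    simp only
    rw [if_neg (by omega), add_zero]

lemma exists_right_inv (P : PseudoDiffOp K) (hP : P ≠ 0) : ∃ X, P * X = 1 := by
  have hPd : ∀ m, P.order < m → P.coeff m = 0 := fun m hm => coeff_eq_zero_of_order_lt hm
  have htop : ∀ n, -P.order < n → ∀ k, (approxInv P k).coeff n = 0 := fun n hn k => by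
    rw [approxInv_coeff_stable P (Nat.zero_le k) (by simpa using hn)]; rfl
  let X : PseudoDiffOp K :=
    ⟨fun n => (approxInv P ((-P.order - n).toNat + 1)).coeff n, -P.order, fun n hn => htop n hn _⟩
  have hX : ∀ n, X.coeff n = (approxInv P ((-P.order - n).toNat + 1)).coeff n := fun _ => rfl
  have hXtop : ∀ n, -P.order < n → X.coeff n = 0 :=
    fun n hn => (hX n).trans (htop n hn _)
  refine ⟨X, ?_⟩
  ext r
  by_cases hr : 0 < r
  · rw [coeff_mul, mulCoeff_eq_zero P X hPd (N₂ := -P.order) hXtop (by omega),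
      coeff_one, if_neg hr.ne']
  · obtain ⟨k, hk⟩ := Int.eq_ofNat_of_zero_le (show 0 ≤ -r by omega)
    obtain rfl : r = -k := by omega
    rw [mul_coeff_congr P (Q' := approxInv P (k + 1)) hPd]
    · rw [approxInv, mul_add, coeff_add]
      have : (P * monomial (-P.order - k) (P.leadingCoeff⁻¹ *
          ((1 : PseudoDiffOp K).coeff (-k) - (P * approxInv P k).coeff (-k)))).coeff (-k) =
          (1 : PseudoDiffOp K).coeff (-k) - (P * approxInv P k).coeff (-k) := by
        have h := mul_coeff_top P (monomial (-P.order - k) (P.leadingCoeff⁻¹ *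
          ((1 : PseudoDiffOp K).coeff (-k) - (P * approxInv P k).coeff (-k)))) hPd
          (e := -P.order - k) (fun m hm => if_neg hm.ne')
        rw [show P.order + (-P.order - k) = -(k : ℤ) by ring] at h
        rw [h]
        simp only [monomial, if_true]
        rw [← mul_assoc]
        change P.leadingCoeff * _ * _ = _
        rw [mul_inv_cancel₀ (leadingCoeff_ne_zero hP), one_mul]
      rw [this]; ring
    · intro n hn
      rw [hX]
      symm
      by_cases hn' : -P.order < n
      · rw [htop n hn', htop n hn']
      · exact approxInv_coeff_stable P (by omega) (by push_cast; omega)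

lemma isUnit_or_eq_zero (P : PseudoDiffOp K) : IsUnit P ∨ P = 0 := by
  by_cases hP : P = 0
  · exact Or.inr hP
  left
  have h10 : (1 : PseudoDiffOp K) ≠ 0 := fun h => by
    simpa [coeff_one] using congrArg (fun Q : PseudoDiffOp K => Q.coeff 0) h
  obtain ⟨X, hX⟩ := P.exists_right_inv hP
  obtain ⟨Y, hY⟩ := X.exists_right_inv (by rintro rfl; exact h10 (by rw [← hX, mul_zero]))
  have : P = Y := by rw [← mul_one P, ← hY, ← mul_assoc, hX, one_mul]
  subst this
  exact ⟨⟨P, X, hX, hY⟩, rfl⟩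

instance : Nontrivial (PseudoDiffOp K) :=
  ⟨1, 0, fun h => by simpa [coeff_one] using congrArg (fun Q : PseudoDiffOp K => Q.coeff 0) h⟩

/-- `K((∂⁻¹))` is a skewfield. -/
noncomputable instance : DivisionRing (PseudoDiffOp K) :=
  DivisionRing.ofIsUnitOrEqZero isUnit_or_eq_zero

/-- The leading term `a λᵈ` of a pseudodifferential operator `a ∂ᵈ + (terms of lower order)` with
`a ≠ 0`, encoded as the pair `(a, d)`, and `0` for the zero operator. The products of the target
are `(a λᵈ) (b λᵉ) = a b λ^(d + e)`. -/
noncomputable def leadingTerm : PseudoDiffOp K →*₀ WithZero (Kˣ × Multiplicative ℤ) where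
  toFun P := open Classical in if h : P = 0 then 0 else
    ((Units.mk0 P.leadingCoeff (leadingCoeff_ne_zero h), Multiplicative.ofAdd P.order) :
      Kˣ × Multiplicative ℤ)
  map_zero' := dif_pos rfl
  map_one' := by
    have ho : (1 : PseudoDiffOp K).order = 0 :=
      order_eq (by simp [coeff_one]) (fun m hm => by rw [coeff_one, if_neg hm.ne'])
    rw [dif_neg one_ne_zero, ← WithZero.coe_one, WithZero.coe_inj]
    refine Prod.ext (Units.ext ?_) ?_
    · simp [leadingCoeff, ho, coeff_one]
    · simp [ho]
  map_mul' P Q := by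
    by_cases hP : P = 0
    · subst hP; rw [zero_mul, dif_pos rfl, zero_mul]
    by_cases hQ : Q = 0
    · subst hQ; rw [mul_zero, dif_pos rfl, mul_zero]
    have h1 := mul_coeff_top P Q (d := P.order) (e := Q.order)
      (fun m hm => coeff_eq_zero_of_order_lt hm) (fun m hm => coeff_eq_zero_of_order_lt hm)
    have ho : (P * Q).order = P.order + Q.order := by
      refine order_eq ?_ (fun m hm => ?_)
      · rw [h1]; exact mul_ne_zero (leadingCoeff_ne_zero hP) (leadingCoeff_ne_zero hQ)
      · exact mulCoeff_eq_zero P Q (fun m hm => coeff_eq_zero_of_order_lt hm)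
          (fun m hm => coeff_eq_zero_of_order_lt hm) hm
    rw [dif_neg (mul_ne_zero hP hQ), dif_neg hP, dif_neg hQ, ← WithZero.coe_mul, WithZero.coe_inj]
    refine Prod.ext (Units.ext ?_) ?_
    · simp only [leadingCoeff, ho, h1, Units.val_mk0, Prod.fst_mul, Units.val_mul]
    · simp only [ho, ofAdd_add, Prod.snd_mul]

end PseudoDiffOp

/-! ## Differential operators and rational pseudodifferential operators -/

section DiffOp

variable (K : Type*) [Field K] [Differential K]

/-- The ring `K[∂]` of differential operators: the pseudodifferential operators in which no
negative power of `∂` occurs. -/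
noncomputable def DiffOp : Subring (PseudoDiffOp K) where
  carrier := {P | ∀ m < 0, P.coeff m = 0}
  zero_mem' := fun _ _ => rfl
  one_mem' := fun m hm => by rw [PseudoDiffOp.coeff_one, if_neg hm.ne]
  add_mem' := fun hP hQ m hm => by rw [PseudoDiffOp.coeff_add, hP m hm, hQ m hm, add_zero]
  neg_mem' := fun hP m hm => by rw [PseudoDiffOp.coeff_neg, hP m hm, neg_zero]
  mul_mem' := by
    intro P Q hP hQ r hr
    rw [PseudoDiffOp.coeff_mul, PseudoDiffOp.mulCoeff]
    refine finsum_eq_zero_of_forall_eq_zero ?_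
    rintro ⟨m, n⟩
    simp only
    by_cases hm : m < 0
    · simp [hP m hm]
    by_cases hn : n < 0
    · simp [hQ n hn]
    obtain ⟨s, hs⟩ := Int.eq_ofNat_of_zero_le (show 0 ≤ m + n - r by omega)
    obtain ⟨k, rfl⟩ := Int.eq_ofNat_of_zero_le (not_lt.mp hm)
    rw [hs, PseudoDiffOp.mulTerm_natCast, Ring.choose_natCast, Nat.choose_eq_zero_of_lt (by omega)]
    simp

/-- The skewfield `K(∂)` of rational pseudodifferential operators: the subskewfield of `K((∂⁻¹))`
generated by `K[∂]`. -/
noncomputable def RatPseudoDiffOp : Subfield (PseudoDiffOp K) :=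
  Subfield.closure (DiffOp K : Set (PseudoDiffOp K))

variable {K}

/-- The inclusion `K[∂] ⊆ K(∂)`. -/
noncomputable def DiffOp.toRat : DiffOp K →+* RatPseudoDiffOp K :=
  Subring.inclusion (show DiffOp K ≤ (RatPseudoDiffOp K).toSubring from Subfield.subset_closure)

/-- The value `P(f) = ∑ₖ aₖ f⁽ᵏ⁾` of a differential operator `P = ∑ₖ aₖ ∂ᵏ` at `f ∈ K`. -/
noncomputable def DiffOp.eval (P : DiffOp K) (f : K) : K :=
  ∑ᶠ k : ℕ, (P : PseudoDiffOp K).coeff k * PseudoDiffOp.iterDeriv k f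

end DiffOp

/-! ## The Dieudonné determinant -/

namespace DieudonneDet

open Matrix

variable {F G : Type*} [DivisionRing F] [CommGroupWithZero G] {n : ℕ}

/-- The functions of a square matrix that behave like a determinant under elementary row
operations. -/
structure RowDet (φ : F →*₀ G) (D : Matrix (Fin n) (Fin n) F → G) : Prop where
  one : D 1 = 1
  add : ∀ M p q, p ≠ q → ∀ a : F, D (updateRow M p (M p + a • M q)) = D M
  smul : ∀ M p, ∀ a : F, D (updateRow M p (a • M p)) = φ a * D M

namespace RowDet

variable {φ : F →*₀ G} {D : Matrix (Fin n) (Fin n) F → G}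

lemma add_sum (h : RowDet φ D) (M : Matrix (Fin n) (Fin n) F) (p : Fin n) (v : Fin n → F)
    (s : Finset (Fin n)) (hs : p ∉ s) :
    D (updateRow M p (M p + ∑ k ∈ s, v k • M k)) = D M := by
  classical
  induction s using Finset.induction_on with
  | empty => simp
  | insert q s hq ih =>
    rw [Finset.mem_insert, not_or] at hs
    refine Eq.trans ?_ ((h.add _ p q hs.1 (v q)).trans (ih hs.2))
    rw [updateRow_self, updateRow_ne (Ne.symm hs.1), updateRow_idem, Finset.sum_insert hq,
      add_comm (v q • M q), ← add_assoc]

lemma comb (h : RowDet φ D) (M : Matrix (Fin n) (Fin n) F) (p : Fin n) (v : Fin n → F) :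
    D (updateRow M p (∑ k, v k • M k)) = φ (v p) * D M := by
  classical
  rw [← h.smul M p (v p),
    ← h.add_sum (updateRow M p (v p • M p)) p v (Finset.univ.erase p) (by simp)]
  congr 1
  rw [updateRow_self, updateRow_idem, ← Finset.add_sum_erase _ _ (Finset.mem_univ p)]
  congr 2
  refine Finset.sum_congr rfl fun k hk => ?_
  rw [updateRow_ne (Finset.ne_of_mem_erase hk)]

lemma singular (h : RowDet φ D) (M : Matrix (Fin n) (Fin n) F) (v : Fin n → F) (hv : v ≠ 0)
    (hM : ∑ k, v k • M k = 0) : D M = 0 := by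
  obtain ⟨p, hp⟩ := Function.ne_iff.mp hv
  have h1 := h.comb M p v
  have h2 := h.smul M p 0
  rw [hM] at h1
  rw [zero_smul, map_zero, zero_mul] at h2
  rw [h2] at h1
  exact (mul_eq_zero.mp h1.symm).resolve_left ((map_ne_zero φ).mpr hp)

lemma add_many (h : RowDet φ D) (M : Matrix (Fin n) (Fin n) F) (p : Fin n) (a : Fin n → F)
    (s : Finset (Fin n)) (hs : p ∉ s) :
    D (of fun k => if k ∈ s then M k + a k • M p else M k) = D M := by
  classical
  induction s using Finset.induction_on with
  | empty => congr 1
  | insert q s hq ih =>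
    rw [Finset.mem_insert, not_or] at hs
    refine Eq.trans ?_ ((h.add _ q p (Ne.symm hs.1) (a q)).trans (ih hs.2))
    congr 1
    refine Matrix.ext fun k j => ?_
    by_cases hk : k = q
    · subst hk
      simp [hq, hs.2]
    · simp [Finset.mem_insert, hk]

/-- The effect of multiplication by `1 - u c`, for a column `u` and a row `c`. -/
lemma rank_one (h : RowDet φ D) (M : Matrix (Fin n) (Fin n) F) (c u : Fin n → F)
    (hcu : 1 - ∑ k, c k * u k ≠ 0) :
    D (of fun k => M k - u k • ∑ j, c j • M j) = φ (1 - ∑ k, c k * u k) * D M := by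
  classical
  by_cases hc : c = 0
  · subst hc
    simp only [Pi.zero_apply, zero_smul, zero_mul, Finset.sum_const_zero, smul_zero, sub_zero,
      map_one, one_mul]
    rfl
  obtain ⟨l, hl⟩ := Function.ne_iff.mp hc
  have hl' : φ (c l) ≠ 0 := (map_ne_zero φ).mpr hl
  obtain ⟨w, hw⟩ : ∃ w, w = ∑ j, c j • M j := ⟨_, rfl⟩
  obtain ⟨t, ht⟩ : ∃ t, t = 1 - ∑ k, c k * u k := ⟨_, rfl⟩
  rw [← hw, ← ht]
  rw [← ht] at hcu
  have e1 := h.comb (of fun k => M k - u k • w) l c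
  have e2 := h.comb M l c
  have hsum : ∑ k, c k • (M k - u k • w) = t • w := by
    simp only [smul_sub, smul_smul, Finset.sum_sub_distrib, ← Finset.sum_smul]
    rw [← hw, ht, sub_smul, one_smul]
  have e1' : D (updateRow (of fun k => M k - u k • w) l (t • w)) =
      φ (c l) * D (of fun k => M k - u k • w) := by
    rw [← hsum]; exact e1
  rw [← hw] at e2
  have e3 := h.smul (updateRow M l w) l t
  rw [updateRow_self, updateRow_idem] at e3
  have e4 := h.add_many (updateRow M l (t • w)) l (fun k => -(u k * t⁻¹))
    (Finset.univ.erase l) (by simp)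
  have e5 : (of fun k => if k ∈ Finset.univ.erase l then
      (updateRow M l (t • w)) k + (-(u k * t⁻¹)) • (updateRow M l (t • w)) l
      else (updateRow M l (t • w)) k) =
      updateRow (of fun k => M k - u k • w) l (t • w) := by
    refine Matrix.ext fun k j => ?_
    by_cases hk : k = l
    · subst hk; simp
    · simp [hk, mul_assoc, inv_mul_cancel_left₀ hcu, sub_eq_add_neg]
  rw [e5] at e4
  refine mul_left_cancel₀ hl' ?_
  rw [← e1', e4, e3, e2]
  exact mul_left_comm _ _ _

end RowDet

/-- Every square matrix over a skewfield is obtained from the identity matrix by elementary row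
operations (where rows may be multiplied by `0`). -/
lemma rowInduction : ∀ {n : ℕ} (p : Matrix (Fin n) (Fin n) F → Prop), p 1 →
    (∀ M i j, i ≠ j → ∀ a : F, p M → p (updateRow M i (M i + a • M j))) →
    (∀ M i, ∀ a : F, p M → p (updateRow M i (a • M i))) → ∀ M, p M := by
  intro n
  induction n with
  | zero => intro p h1 _ _ M; rwa [Subsingleton.elim M 1]
  | succ n ih =>
    intro p h1 hadd hsmul
    -- operations can be undone
    have hundo : ∀ M i j, i ≠ j → ∀ a : F, p (updateRow M i (M i + a • M j)) → p M := by
      intro M i j hij a h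
      have := hadd _ i j hij (-a) h
      rw [updateRow_self, updateRow_ne hij.symm, updateRow_idem, add_assoc, ← add_smul,
        add_neg_cancel, zero_smul, add_zero, updateRow_eq_self] at this
      exact this
    -- matrices with first column zero below the diagonal
    have hblock : ∀ M : Matrix (Fin (n + 1)) (Fin (n + 1)) F, (∀ i : Fin n, M i.succ 0 = 0) →
        p M := by
      intro M hM
      let B : Matrix (Fin n) (Fin n) F → Matrix (Fin (n + 1)) (Fin (n + 1)) F :=
        fun N => Fin.cons (M 0) (fun i => Fin.cons 0 (N i))
      have hB0 : ∀ N, B N 0 = M 0 := fun N => rfl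
      have hBs : ∀ N i, B N (Fin.succ i) = Fin.cons 0 (N i) := fun N i => rfl
      have hupd : ∀ N i v, B (updateRow N i v) = updateRow (B N) i.succ (Fin.cons 0 v) := by
        intro N i v
        funext k
        refine Fin.cases ?_ (fun k => ?_) k
        · rw [updateRow_ne (Fin.succ_ne_zero i).symm]; rfl
        · by_cases hk : k = i
          · subst hk; rw [updateRow_self, hBs, updateRow_self]
          · rw [updateRow_ne (by simpa using hk), hBs, hBs, updateRow_ne hk]
      have key : ∀ N, p (B N) := by
        refine ih (fun N => p (B N)) ?_ ?_ ?_
        · -- the identity block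
          have step : ∀ s : Finset (Fin n), p (updateRow (1 : Matrix (Fin (n + 1)) (Fin (n + 1)) F)
              0 (M 0 0 • (1 : Matrix (Fin (n + 1)) (Fin (n + 1)) F) 0 +
                ∑ k ∈ s, M 0 k.succ • (1 : Matrix (Fin (n + 1)) (Fin (n + 1)) F) k.succ)) := by
            intro s
            classical
            induction s using Finset.induction_on with
            | empty => simpa using hsmul 1 0 (M 0 0) h1
            | insert q s hq ih' =>
              have := hadd _ 0 q.succ (Fin.succ_ne_zero q).symm (M 0 q.succ) ih'
              rw [updateRow_self, updateRow_idem, updateRow_ne (Fin.succ_ne_zero q)] at this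
              rw [Finset.sum_insert hq, add_comm (M 0 q.succ • _), ← add_assoc]
              exact this
          have := step Finset.univ
          convert this using 1
          funext k
          refine Fin.cases ?_ (fun k => ?_) k
          · rw [updateRow_self, hB0]
            funext j
            rw [← Fin.sum_univ_succ (fun k : Fin (n + 1) =>
              M 0 k • (1 : Matrix (Fin (n + 1)) (Fin (n + 1)) F) k)]
            simp [Finset.sum_apply, Matrix.one_apply]
          · rw [updateRow_ne (Fin.succ_ne_zero k), hBs]
            funext j
            refine Fin.cases ?_ (fun j => ?_) j
            · simp
            · simp [Matrix.one_apply]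
        · intro N i j hij a hN
          have := hadd _ i.succ j.succ (by simpa using hij) a hN
          rw [hupd]
          convert this using 2
          rw [hBs, hBs]
          funext k
          refine Fin.cases ?_ (fun k => ?_) k <;> simp
        · intro N i a hN
          have := hsmul _ i.succ a hN
          rw [hupd]
          convert this using 2
          rw [hBs]
          funext k
          refine Fin.cases ?_ (fun k => ?_) k <;> simp
      have hMB : M = B (fun i j => M i.succ j.succ) := by
        funext i
        refine Fin.cases rfl (fun i => ?_) i
        refine Eq.trans ?_ (hBs _ i).symm
        funext j
        refine Fin.cases ?_ (fun j => ?_) j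
        · simpa using hM i
        · simp
      rw [hMB]
      exact key _
    -- matrices with nonzero upper left corner
    have hpivot : ∀ M : Matrix (Fin (n + 1)) (Fin (n + 1)) F, M 0 0 ≠ 0 → p M := by
      intro M hM
      have step : ∀ s : Finset (Fin n), ∀ M : Matrix (Fin (n + 1)) (Fin (n + 1)) F, M 0 0 ≠ 0 →
          (∀ i, i ∉ s → M (Fin.succ i) 0 = 0) → p M := by
        intro s
        classical
        induction s using Finset.induction_on with
        | empty => intro M _ h; exact hblock M (fun i => h i (by simp))
        | insert q s hq ih' =>
          intro M hM h
          refine hundo M q.succ 0 (Fin.succ_ne_zero q) (-(M q.succ 0 * (M 0 0)⁻¹))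
            (ih' _ ?_ ?_)
          · rw [updateRow_ne (Fin.succ_ne_zero q).symm]; exact hM
          · intro i hi
            by_cases hiq : i = q
            · subst hiq
              rw [updateRow_self, Pi.add_apply, Pi.smul_apply, smul_eq_mul, neg_mul, mul_assoc,
                inv_mul_cancel₀ hM, mul_one, add_neg_cancel]
            · rw [updateRow_ne (by simpa using hiq)]
              exact h i (by simp [hiq, hi])
      exact step Finset.univ M hM (by simp)
    intro M
    by_cases h0 : M 0 0 = 0
    · by_cases h : ∃ i : Fin n, M i.succ 0 ≠ 0
      · obtain ⟨i, hi⟩ := h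
        refine hundo M 0 i.succ (Fin.succ_ne_zero i).symm 1 (hpivot _ ?_)
        simpa [h0] using hi
      · push Not at h
        exact hblock M h
    · exact hpivot M h0

lemma RowDet.mul {φ : F →*₀ G} {D : Matrix (Fin n) (Fin n) F → G} (h : RowDet φ D)
    (A B : Matrix (Fin n) (Fin n) F) : D (A * B) = D A * D B := by
  have hrow : ∀ (M : Matrix (Fin n) (Fin n) F) i v,
      updateRow M i v * B = updateRow (M * B) i (v ᵥ* B) := by
    intro M i v
    funext k
    by_cases hk : k = i
    · subst hk; rw [updateRow_self]; funext j; simp [Matrix.mul_apply, vecMul, dotProduct]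
    · rw [updateRow_ne hk]; funext j; simp [Matrix.mul_apply, updateRow_ne hk]
  have hv : ∀ (M : Matrix (Fin n) (Fin n) F) i, M i ᵥ* B = (M * B) i := fun M i => rfl
  refine rowInduction (fun A => D (A * B) = D A * D B) ?_ ?_ ?_ A
  · rw [one_mul, h.one, one_mul]
  · intro M i j hij a hM
    rw [hrow, add_vecMul, smul_vecMul, hv, hv, h.add _ i j hij, h.add _ i j hij, hM]
  · intro M i a hM
    rw [hrow, smul_vecMul, hv, h.smul, h.smul, hM, mul_assoc]

/-- The first row plus a combination of the other rows. -/
def pivotRow (A : Matrix (Fin (n + 1)) (Fin (n + 1)) F) (c : Fin n → F) : Fin (n + 1) → F :=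
  A 0 + ∑ k, c k • A k.succ

/-- Elimination of the first entry of `v` by means of `r`. -/
def elimRow (r v : Fin (n + 1) → F) : Fin n → F :=
  fun j => v j.succ - v 0 * (r 0)⁻¹ * r j.succ

/-- Elimination of the first column by means of the row `r`. -/
def elimMat (A : Matrix (Fin (n + 1)) (Fin (n + 1)) F) (r : Fin (n + 1) → F) :
    Matrix (Fin n) (Fin n) F :=
  fun k => elimRow r (A k.succ)

/-- Gaussian elimination. -/
noncomputable def gaussDet (φ : F →*₀ G) : (n : ℕ) → Matrix (Fin n) (Fin n) F → G
  | 0, _ => 1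
  | n + 1, A => open Classical in
    if h : ∃ c : Fin n → F, pivotRow A c 0 ≠ 0 then
      φ (pivotRow A h.choose 0) * gaussDet φ n (elimMat A (pivotRow A h.choose))
    else 0

lemma elimRow_add (r v w : Fin (n + 1) → F) : elimRow r (v + w) = elimRow r v + elimRow r w := by
  funext j; simp only [elimRow, Pi.add_apply, add_mul]; abel

lemma elimRow_smul (r v : Fin (n + 1) → F) (a : F) : elimRow r (a • v) = a • elimRow r v := by
  funext j; simp only [elimRow, Pi.smul_apply, smul_eq_mul, mul_sub, mul_assoc]

lemma elimRow_sum (r : Fin (n + 1) → F) (v : Fin n → Fin (n + 1) → F) (c : Fin n → F) :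
    elimRow r (∑ k, c k • v k) = ∑ k, c k • elimRow r (v k) := by
  have : ∀ s : Finset (Fin n), elimRow r (∑ k ∈ s, c k • v k) = ∑ k ∈ s, c k • elimRow r (v k) := by
    intro s
    classical
    induction s using Finset.induction_on with
    | empty => funext j; simp [elimRow]
    | insert q s hq ih => rw [Finset.sum_insert hq, Finset.sum_insert hq, elimRow_add, ih,
        elimRow_smul]
  exact this _

lemma elimRow_self {r : Fin (n + 1) → F} (hr : r 0 ≠ 0) : elimRow r r = 0 := by
  funext j; simp [elimRow, mul_inv_cancel₀ hr]

lemma gaussDet_indep {φ : F →*₀ G} {D : Matrix (Fin n) (Fin n) F → G} (h : RowDet φ D)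
    (A : Matrix (Fin (n + 1)) (Fin (n + 1)) F) (c d : Fin n → F)
    (hc : pivotRow A c 0 ≠ 0) (hd : pivotRow A d 0 ≠ 0) :
    φ (pivotRow A d 0) * D (elimMat A (pivotRow A d)) =
      φ (pivotRow A c 0) * D (elimMat A (pivotRow A c)) := by
  obtain ⟨r, hr⟩ : ∃ r, r = pivotRow A c := ⟨_, rfl⟩
  obtain ⟨t, ht⟩ : ∃ t, t = pivotRow A d := ⟨_, rfl⟩
  rw [← hr, ← ht]
  rw [← hr] at hc
  rw [← ht] at hd
  have hs : t = r + ∑ k, (d k - c k) • A k.succ := by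
    rw [hr, ht, pivotRow, pivotRow]
    simp only [sub_smul, Finset.sum_sub_distrib]
    abel
  have hL : elimRow r t = ∑ k, (d k - c k) • elimMat A r k := by
    rw [hs, elimRow_add, elimRow_self hc, zero_add, elimRow_sum]; rfl
  have h0 : 1 - ∑ k : Fin n, (d k - c k) * (A k.succ 0 * (t 0)⁻¹) = r 0 * (t 0)⁻¹ := by
    have : t 0 = r 0 + ∑ k, (d k - c k) * A k.succ 0 := by
      conv_lhs => rw [hs]
      simp [Finset.sum_apply]
    simp only [← mul_assoc]
    rw [← Finset.sum_mul, show ∑ k, (d k - c k) * A k.succ 0 = t 0 - r 0 by rw [this]; abel,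
      sub_mul, mul_inv_cancel₀ hd]
    abel
  have hM : elimMat A t = of fun k => elimMat A r k - (A k.succ 0 * (t 0)⁻¹) •
      ∑ j, (d j - c j) • elimMat A r j := by
    funext k
    rw [← hL]
    funext j
    change _ = elimMat A r k j - (A k.succ 0 * (t 0)⁻¹) • elimRow r t j
    simp only [elimMat, elimRow, smul_eq_mul, mul_sub]
    rw [← mul_assoc (A k.succ 0 * (t 0)⁻¹) (t 0 * (r 0)⁻¹), ← mul_assoc (A k.succ 0 * (t 0)⁻¹),
      mul_assoc (A k.succ 0) (t 0)⁻¹ (t 0), inv_mul_cancel₀ hd, mul_one]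
    abel
  have hne : r 0 * (t 0)⁻¹ ≠ 0 := mul_ne_zero hc (inv_ne_zero hd)
  rw [hM, h.rank_one _ _ _ (by rw [h0]; exact hne), h0, map_mul, map_inv₀]
  have : φ (t 0) ≠ 0 := (map_ne_zero φ).mpr hd
  field_simp

lemma gaussDet_eq {φ : F →*₀ G} (h : RowDet φ (gaussDet φ n))
    (A : Matrix (Fin (n + 1)) (Fin (n + 1)) F) (c : Fin n → F) (hc : pivotRow A c 0 ≠ 0) :
    gaussDet φ (n + 1) A = φ (pivotRow A c 0) * gaussDet φ n (elimMat A (pivotRow A c)) := by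
  have hex : ∃ c : Fin n → F, pivotRow A c 0 ≠ 0 := ⟨c, hc⟩
  rw [gaussDet, dif_pos hex]
  exact gaussDet_indep h A c _ hc hex.choose_spec

lemma gaussDet_eq_zero {φ : F →*₀ G} (A : Matrix (Fin (n + 1)) (Fin (n + 1)) F)
    (h : ∀ i, A i 0 = 0) : gaussDet φ (n + 1) A = 0 := by
  rw [gaussDet, dif_neg]
  rintro ⟨c, hc⟩
  exact hc (by simp [pivotRow, Finset.sum_apply, h])

lemma exists_pivot (A : Matrix (Fin (n + 1)) (Fin (n + 1)) F) (h : ∃ i, A i 0 ≠ 0) :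
    ∃ c : Fin n → F, pivotRow A c 0 ≠ 0 := by
  by_cases h0 : A 0 0 = 0
  · obtain ⟨i, hi⟩ := h
    obtain ⟨k, rfl⟩ := Fin.exists_succ_eq.mpr (show i ≠ 0 by rintro rfl; exact hi h0)
    exact ⟨Pi.single k 1, by simpa [pivotRow, Finset.sum_apply, Pi.single_apply, h0] using hi⟩
  · exact ⟨0, by simpa [pivotRow] using h0⟩

lemma pivotRow_update (A : Matrix (Fin (n + 1)) (Fin (n + 1)) F) (c : Fin n → F) (q : Fin n)
    (x : F) : pivotRow A (Function.update c q x) = pivotRow A c + (x - c q) • A q.succ := by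
  classical
  have hu : Function.update c q x = c + Pi.single q (x - c q) := by
    funext k
    by_cases hk : k = q
    · subst hk; simp
    · simp [hk]
  rw [hu, pivotRow, pivotRow]
  simp only [Pi.add_apply, add_smul, Finset.sum_add_distrib, Pi.single_apply, ite_smul, zero_smul,
    Finset.sum_ite_eq', Finset.mem_univ, if_true, add_assoc]

lemma pivotRow_updateRow_succ (A : Matrix (Fin (n + 1)) (Fin (n + 1)) F) (c : Fin n → F)
    (p : Fin n) (v : Fin (n + 1) → F) :
    pivotRow (updateRow A p.succ (A p.succ + v)) c = pivotRow A c + c p • v := by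
  classical
  have : ∀ k : Fin n, c k • updateRow A p.succ (A p.succ + v) k.succ =
      c k • A k.succ + if k = p then c k • v else 0 := by
    intro k
    by_cases hk : k = p
    · subst hk; simp
    · rw [updateRow_ne (by simpa using hk), if_neg hk, add_zero]
  rw [pivotRow, pivotRow, updateRow_ne (Fin.succ_ne_zero p).symm]
  simp only [this, Finset.sum_add_distrib, Finset.sum_ite_eq', Finset.mem_univ, if_true, add_assoc]

lemma pivotRow_updateRow_zero (A : Matrix (Fin (n + 1)) (Fin (n + 1)) F) (c : Fin n → F)
    (v : Fin (n + 1) → F) :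
    pivotRow (updateRow A 0 v) c = v + ∑ k, c k • A k.succ := by
  rw [pivotRow, updateRow_self]
  congr 1

lemma elimMat_updateRow_succ (A : Matrix (Fin (n + 1)) (Fin (n + 1)) F) (r : Fin (n + 1) → F)
    (p : Fin n) (v : Fin (n + 1) → F) :
    elimMat (updateRow A p.succ v) r = updateRow (elimMat A r) p (elimRow r v) := by
  funext k
  by_cases hk : k = p
  · subst hk; rw [updateRow_self, elimMat, updateRow_self]
  · rw [updateRow_ne hk, elimMat, updateRow_ne (by simpa using hk)]; rfl

lemma elimMat_updateRow_zero (A : Matrix (Fin (n + 1)) (Fin (n + 1)) F) (r : Fin (n + 1) → F)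
    (v : Fin (n + 1) → F) : elimMat (updateRow A 0 v) r = elimMat A r := rfl

lemma gaussDet_one {φ : F →*₀ G} (h : RowDet φ (gaussDet φ n)) :
    gaussDet φ (n + 1) (1 : Matrix (Fin (n + 1)) (Fin (n + 1)) F) = 1 := by
  have hp : pivotRow (1 : Matrix (Fin (n + 1)) (Fin (n + 1)) F) 0 =
      (1 : Matrix (Fin (n + 1)) (Fin (n + 1)) F) 0 := by simp [pivotRow]
  rw [gaussDet_eq h 1 0 (by rw [hp]; simp), hp]
  have : elimMat (1 : Matrix (Fin (n + 1)) (Fin (n + 1)) F)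
      ((1 : Matrix (Fin (n + 1)) (Fin (n + 1)) F) 0) = 1 := by
    funext k j
    simp [elimMat, elimRow, Matrix.one_apply]
  rw [this, h.one]; simp

lemma gaussDet_smul {φ : F →*₀ G} (h : RowDet φ (gaussDet φ n))
    (A : Matrix (Fin (n + 1)) (Fin (n + 1)) F) (p : Fin (n + 1)) (a : F) :
    gaussDet φ (n + 1) (updateRow A p (a • A p)) = φ a * gaussDet φ (n + 1) A := by
  classical
  by_cases hA : ∃ i, A i 0 ≠ 0
  swap
  · push Not at hA
    rw [gaussDet_eq_zero A hA, mul_zero]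
    refine gaussDet_eq_zero _ fun i => ?_
    by_cases hi : i = p
    · subst hi; simp [hA]
    · rw [updateRow_ne hi, hA]
  by_cases ha : a = 0
  · subst ha
    rw [zero_smul, map_zero, zero_mul]
    by_cases hA' : ∃ i, updateRow A p 0 i 0 ≠ 0
    swap
    · push Not at hA'
      exact gaussDet_eq_zero _ hA'
    obtain ⟨c, hc⟩ := exists_pivot _ hA'
    rw [gaussDet_eq h _ c hc, mul_eq_zero]
    right
    revert hc
    refine Fin.cases ?_ (fun p => ?_) p
    · intro hc
      have hc0 : c ≠ 0 := by
        rintro rfl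
        exact hc (by simp [pivotRow])
      refine h.singular _ c hc0 ?_
      have e : pivotRow (updateRow A 0 0) c = ∑ k : Fin n, c k • A k.succ := by
        rw [pivotRow_updateRow_zero, zero_add]
      have e2 := elimRow_self hc
      conv at e2 => lhs; arg 2; rw [e]
      rw [elimRow_sum] at e2
      exact e2
    · intro hc
      have h0 : elimRow (pivotRow (updateRow A p.succ 0) c) 0 = 0 := by
        funext j; simp [elimRow]
      rw [elimMat_updateRow_succ, h0]
      have := h.smul (elimMat A (pivotRow (updateRow A p.succ 0) c)) p 0
      rwa [zero_smul, map_zero, zero_mul] at this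
  · obtain ⟨c, hc⟩ := exists_pivot A hA
    revert hc
    refine Fin.cases ?_ (fun p => ?_) p
    · intro hc
      have e : pivotRow (updateRow A 0 (a • A 0)) (a • c) = a • pivotRow A c := by
        rw [pivotRow_updateRow_zero, pivotRow, smul_add, Finset.smul_sum]
        simp [smul_smul]
      have hel : elimMat (updateRow A 0 (a • A 0)) (a • pivotRow A c) =
          elimMat A (pivotRow A c) := by
        funext k j
        rw [elimMat_updateRow_zero]
        simp only [elimMat, elimRow, Pi.smul_apply, smul_eq_mul, _root_.mul_inv_rev]
        rw [mul_assoc, mul_assoc, inv_mul_cancel_left₀ ha, ← mul_assoc]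
      rw [gaussDet_eq h _ (a • c) (by rw [e]; simpa [ha] using hc), gaussDet_eq h A c hc, e, hel,
        Pi.smul_apply, smul_eq_mul, map_mul, mul_assoc]
    · intro hc
      have e : pivotRow (updateRow A p.succ (a • A p.succ))
          (Function.update c p (c p * a⁻¹)) = pivotRow A c := by
        rw [pivotRow_update, updateRow_self,
          show a • A p.succ = A p.succ + (a - 1) • A p.succ by rw [sub_smul, one_smul]; abel,
          pivotRow_updateRow_succ, add_assoc, smul_smul,
          show A p.succ + (a - 1) • A p.succ = a • A p.succ by rw [sub_smul, one_smul]; abel,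
          smul_smul, ← add_smul, sub_mul, mul_assoc (c p), inv_mul_cancel₀ ha, mul_sub]
        simp
      rw [gaussDet_eq h _ (Function.update c p (c p * a⁻¹)) (by rw [e]; exact hc),
        gaussDet_eq h A c hc, e, elimMat_updateRow_succ, elimRow_smul]
      have := h.smul (elimMat A (pivotRow A c)) p a
      rw [show elimRow (pivotRow A c) (A p.succ) = elimMat A (pivotRow A c) p from rfl, this]
      exact mul_left_comm _ _ _

lemma gaussDet_add {φ : F →*₀ G} (h : RowDet φ (gaussDet φ n))
    (A : Matrix (Fin (n + 1)) (Fin (n + 1)) F) (p q : Fin (n + 1)) (hpq : p ≠ q) (a : F) :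
    gaussDet φ (n + 1) (updateRow A p (A p + a • A q)) = gaussDet φ (n + 1) A := by
  classical
  by_cases hA : ∃ i, A i 0 ≠ 0
  swap
  · push Not at hA
    rw [gaussDet_eq_zero A hA]
    refine gaussDet_eq_zero _ fun i => ?_
    by_cases hi : i = p
    · subst hi; simp [hA]
    · rw [updateRow_ne hi, hA]
  revert hpq
  refine Fin.cases ?_ (fun p => ?_) p
  · intro hpq
    obtain ⟨q, rfl⟩ := Fin.exists_succ_eq.mpr hpq.symm
    obtain ⟨c, hc⟩ := exists_pivot A hA
    have e : pivotRow (updateRow A 0 (A 0 + a • A q.succ)) (Function.update c q (c q - a)) =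
        pivotRow A c := by
      rw [pivotRow_update, pivotRow_updateRow_zero, updateRow_ne (Fin.succ_ne_zero q), pivotRow,
        sub_sub_cancel_left, neg_smul]
      abel
    rw [gaussDet_eq h _ (Function.update c q (c q - a)) (by rw [e]; exact hc),
      gaussDet_eq h A c hc, e, elimMat_updateRow_zero]
  · refine Fin.cases ?_ (fun q => ?_) q
    · intro _
      by_cases hex : ∃ c : Fin n → F, pivotRow A c 0 ≠ 0 ∧ c p = 0
      · obtain ⟨c, hc, hcp⟩ := hex
        have e : pivotRow (updateRow A p.succ (A p.succ + a • A 0)) c = pivotRow A c := by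
          rw [pivotRow_updateRow_succ, hcp, zero_smul, add_zero]
        rw [gaussDet_eq h _ c (by rw [e]; exact hc), gaussDet_eq h A c hc, e,
          elimMat_updateRow_succ, elimRow_add, elimRow_smul]
        have e2 : elimRow (pivotRow A c) (A 0) =
            ∑ k ∈ Finset.univ.erase p, (-c k) • elimMat A (pivotRow A c) k := by
          have e3 := elimRow_self hc
          conv at e3 => lhs; arg 2; rw [pivotRow]
          rw [elimRow_add, elimRow_sum, ← Finset.add_sum_erase _ _ (Finset.mem_univ p), hcp,
            zero_smul, zero_add] at e3
          rw [eq_neg_of_add_eq_zero_left e3, ← Finset.sum_neg_distrib]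
          simp only [neg_smul]
          rfl
        rw [e2, Finset.smul_sum]
        have := h.add_sum (elimMat A (pivotRow A c)) p (fun k => a * -c k)
          (Finset.univ.erase p) (by simp)
        simp only [smul_smul]
        rw [show elimRow (pivotRow A c) (A p.succ) = elimMat A (pivotRow A c) p from rfl, this]
      · push Not at hex
        have h0 : A 0 0 = 0 := by
          by_contra hc
          exact hex 0 (by simpa [pivotRow] using hc) rfl
        have hk : ∀ k : Fin n, k ≠ p → A k.succ 0 = 0 := by
          intro k hk
          by_contra hc
          refine hex (Pi.single k 1) ?_ ?_
          · simpa [pivotRow, Finset.sum_apply, Pi.single_apply, h0] using hc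
          · simp [hk.symm]
        have hp : A p.succ 0 ≠ 0 := by
          obtain ⟨i, hi⟩ := hA
          obtain ⟨k, rfl⟩ := Fin.exists_succ_eq.mpr (show i ≠ 0 by rintro rfl; exact hi h0)
          by_cases hkp : k = p
          · rwa [← hkp]
          · exact absurd (hk k hkp) hi
        have e1 : pivotRow A (Pi.single p 1) = A 0 + A p.succ := by
          simp [pivotRow, Pi.single_apply]
        have e2 : pivotRow (updateRow A p.succ (A p.succ + a • A 0)) (Pi.single p 1) =
            A 0 + A p.succ + a • A 0 := by
          rw [pivotRow_updateRow_succ, e1]; simp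
        have hz1 : (A 0 + A p.succ) 0 = A p.succ 0 := by simp [h0]
        have hz2 : (A 0 + A p.succ + a • A 0) 0 = A p.succ 0 := by simp [h0]
        rw [gaussDet_eq h _ (Pi.single p 1) (by rw [e2, hz2]; exact hp),
          gaussDet_eq h A (Pi.single p 1) (by rw [e1, hz1]; exact hp), e1, e2, hz1, hz2]
        congr 2
        rw [elimMat_updateRow_succ]
        funext k
        by_cases hkp : k = p
        · subst hkp
          rw [updateRow_self]
          funext j
          simp [elimMat, elimRow, h0, mul_inv_cancel₀ hp]
        · rw [updateRow_ne hkp]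
          funext j
          simp [elimMat, elimRow, hk k hkp]
    · intro hpq
      obtain ⟨c, hc⟩ := exists_pivot A hA
      have hpq' : q ≠ p := fun h => hpq (by rw [h])
      have e : pivotRow (updateRow A p.succ (A p.succ + a • A q.succ))
          (Function.update c q (c q - c p * a)) = pivotRow A c := by
        rw [pivotRow_update, pivotRow_updateRow_succ, updateRow_ne (by simpa using hpq'),
          sub_sub_cancel_left, neg_smul, smul_smul, add_neg_cancel_right]
      rw [gaussDet_eq h _ (Function.update c q (c q - c p * a)) (by rw [e]; exact hc),
        gaussDet_eq h A c hc, e, elimMat_updateRow_succ, elimRow_add, elimRow_smul]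
      have := h.add (elimMat A (pivotRow A c)) p q hpq'.symm a
      rw [show elimRow (pivotRow A c) (A p.succ) = elimMat A (pivotRow A c) p from rfl,
        show elimRow (pivotRow A c) (A q.succ) = elimMat A (pivotRow A c) q from rfl, this]

lemma rowDet_gaussDet (φ : F →*₀ G) : ∀ n, RowDet φ (gaussDet φ n)
  | 0 => ⟨rfl, fun _ p => p.elim0, fun _ p => p.elim0⟩
  | n + 1 => ⟨gaussDet_one (rowDet_gaussDet φ n), gaussDet_add (rowDet_gaussDet φ n),
      gaussDet_smul (rowDet_gaussDet φ n)⟩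

lemma gaussDet_triangular (φ : F →*₀ G) : ∀ (n : ℕ) (T : Matrix (Fin n) (Fin n) F),
    (∀ i j, j < i → T i j = 0) → gaussDet φ n T = ∏ i, φ (T i i)
  | 0, _, _ => by simp [gaussDet]
  | n + 1, T, hT => by
    have hcol : ∀ k : Fin n, T k.succ 0 = 0 := fun k => hT _ _ (Fin.succ_pos k)
    rw [Fin.prod_univ_succ]
    by_cases h0 : T 0 0 = 0
    · rw [h0, map_zero, zero_mul]
      exact gaussDet_eq_zero T fun i => Fin.cases h0 hcol i
    · have e : pivotRow T 0 = T 0 := by simp [pivotRow]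
      rw [gaussDet_eq (rowDet_gaussDet φ n) T 0 (by rw [e]; exact h0), e]
      have e2 : elimMat T (T 0) = fun k j => T k.succ j.succ := by
        funext k j; simp [elimMat, elimRow, hcol]
      rw [e2, gaussDet_triangular φ n _ (fun i j hij => hT _ _ (Fin.succ_lt_succ_iff.mpr hij))]

/-- Existence and uniqueness of the Dieudonné determinant of `n × n` matrices over a skewfield `F`
with respect to a multiplicative map `φ` from `F` to an abelian group with zero: the multiplicative
function that is the product of the values of `φ` on the diagonal for upper triangular matrices. -/
theorem existsUnique (φ : F →*₀ G) (n : ℕ) :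
    ∃! D : Matrix (Fin n) (Fin n) F →* G,
      ∀ T : Matrix (Fin n) (Fin n) F, (∀ i j, j < i → T i j = 0) → D T = ∏ i, φ (T i i) := by
  classical
  refine ⟨⟨⟨gaussDet φ n, (rowDet_gaussDet φ n).one⟩, (rowDet_gaussDet φ n).mul⟩,
    gaussDet_triangular φ n, ?_⟩
  intro D hD
  have hrow : ∀ (M : Matrix (Fin n) (Fin n) F) i (v : Fin n → F),
      updateRow M i (v ᵥ* M) = updateRow 1 i v * M := by
    intro M i v
    funext k
    by_cases hk : k = i
    · subst hk; rw [updateRow_self]; funext j; simp [Matrix.mul_apply, vecMul, dotProduct]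
    · rw [updateRow_ne hk]; funext j
      rw [Matrix.mul_apply, updateRow_ne hk, ← Matrix.mul_apply, one_mul]
  have hone : ∀ (M : Matrix (Fin n) (Fin n) F) i, M i =
      (1 : Matrix (Fin n) (Fin n) F) i ᵥ* M := by
    intro M i
    change M i = ((1 : Matrix (Fin n) (Fin n) F) * M) i
    rw [one_mul]
  -- elementary matrices
  have hup : ∀ i j : Fin n, i < j → ∀ a : F, D (updateRow (1 : Matrix (Fin n) (Fin n) F) i
      ((1 : Matrix (Fin n) (Fin n) F) i + a • (1 : Matrix (Fin n) (Fin n) F) j)) = 1 := by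
    intro i j hij a
    rw [hD]
    · refine Finset.prod_eq_one fun k _ => ?_
      by_cases hk : k = i
      · subst hk; simp [hij.ne']
      · rw [updateRow_ne hk]; simp
    · intro k l hkl
      by_cases hk : k = i
      · subst hk; simp [hkl.ne', (hkl.trans hij).ne']
      · rw [updateRow_ne hk]; simp [hkl.ne']
  have hel : ∀ i j : Fin n, i ≠ j → ∀ a : F, D (updateRow (1 : Matrix (Fin n) (Fin n) F) i
      ((1 : Matrix (Fin n) (Fin n) F) i + a • (1 : Matrix (Fin n) (Fin n) F) j)) = 1 := by
    intro i j hij a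
    rcases lt_or_gt_of_ne hij with h | h
    · exact hup i j h a
    · let W : Matrix (Fin n) (Fin n) F := (1 : Matrix (Fin n) (Fin n) F).submatrix (Equiv.swap i j) id
      have hWl : ∀ M : Matrix (Fin n) (Fin n) F, W * M = M.submatrix (Equiv.swap i j) id := by
        intro M
        funext k l
        simp [W, Matrix.mul_apply, Matrix.one_apply]
      have hWr : ∀ M : Matrix (Fin n) (Fin n) F, M * W = M.submatrix id (Equiv.swap i j) := by
        intro M
        funext k l
        have : ∀ x, (Equiv.swap i j x = l) ↔ (x = Equiv.swap i j l) := fun x => by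
          rw [← Equiv.apply_eq_iff_eq (Equiv.swap i j) (x := x), Equiv.swap_apply_self]
        simp [W, Matrix.mul_apply, Matrix.one_apply, this]
      have hWW : W * W = 1 := by
        rw [hWl]; funext k l; change (1 : Matrix (Fin n) (Fin n) F) (Equiv.swap i j (Equiv.swap i j k)) l = _
        rw [Equiv.swap_apply_self]
      have hconj : updateRow (1 : Matrix (Fin n) (Fin n) F) i
          ((1 : Matrix (Fin n) (Fin n) F) i + a • (1 : Matrix (Fin n) (Fin n) F) j) =
          W * updateRow (1 : Matrix (Fin n) (Fin n) F) j
          ((1 : Matrix (Fin n) (Fin n) F) j + a • (1 : Matrix (Fin n) (Fin n) F) i) * W := by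
        rw [hWl, hWr]
        have hs : ∀ x y : Fin n, (1 : Matrix (Fin n) (Fin n) F) (Equiv.swap i j x)
            (Equiv.swap i j y) = (1 : Matrix (Fin n) (Fin n) F) x y := by
          intro x y; simp [Matrix.one_apply]
        have hsi : ∀ y : Fin n, (1 : Matrix (Fin n) (Fin n) F) i (Equiv.swap i j y) =
            (1 : Matrix (Fin n) (Fin n) F) j y := by
          intro y; rw [← hs j y, Equiv.swap_apply_right]
        have hsj : ∀ y : Fin n, (1 : Matrix (Fin n) (Fin n) F) j (Equiv.swap i j y) =
            (1 : Matrix (Fin n) (Fin n) F) i y := by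
          intro y; rw [← hs i y, Equiv.swap_apply_left]
        funext k l
        simp only [submatrix_apply, id]
        by_cases hk : k = i
        · subst hk
          rw [updateRow_self, Equiv.swap_apply_left, updateRow_self]
          simp only [Pi.add_apply, Pi.smul_apply, hsi, hsj]
        · have hk' : Equiv.swap i j k ≠ j := fun e => hk (by
            rw [← Equiv.swap_apply_self i j k, e, Equiv.swap_apply_right])
          rw [updateRow_ne hk, updateRow_ne hk', hs]
      rw [hconj, map_mul, map_mul, hup j i h, mul_one, ← map_mul, hWW, map_one]
  have hsc : ∀ (i : Fin n) (a : F), D (updateRow (1 : Matrix (Fin n) (Fin n) F) i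
      (a • (1 : Matrix (Fin n) (Fin n) F) i)) = φ a := by
    intro i a
    rw [hD]
    · rw [Finset.prod_eq_single i]
      · simp
      · intro k _ hk; rw [updateRow_ne hk]; simp
      · simp
    · intro k l hkl
      by_cases hk : k = i
      · subst hk; simp [hkl.ne']
      · rw [updateRow_ne hk]; simp [hkl.ne']
  ext M
  change D M = gaussDet φ n M
  have hg := rowDet_gaussDet φ n
  refine rowInduction (fun M => D M = gaussDet φ n M) (by rw [map_one, hg.one]) ?_ ?_ M
  · intro M i j hij a hM
    rw [hg.add M i j hij, ← hM]
    have : M i + a • M j = ((1 : Matrix (Fin n) (Fin n) F) i +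
        a • (1 : Matrix (Fin n) (Fin n) F) j) ᵥ* M := by
      rw [add_vecMul, smul_vecMul, ← hone, ← hone]
    rw [this, hrow, map_mul, hel i j hij, one_mul]
  · intro M i a hM
    rw [hg.smul, ← hM]
    have : a • M i = (a • (1 : Matrix (Fin n) (Fin n) F) i) ᵥ* M := by
      rw [smul_vecMul, ← hone]
    rw [this, hrow, map_mul, hsc]

end DieudonneDet

/-! ## Matrix differential operators and their fractions -/

section Fractions

variable {K : Type*} [Field K] [Differential K] {n : ℕ}

/-- The Dieudonné determinant `det A = det₁(A) λ^d(A)` of a matrix pseudodifferential operator: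
the unique multiplicative function whose value on an upper triangular matrix is the product of the
leading terms of its diagonal entries (so it is `0` if one of these entries is `0`). -/
noncomputable def dieudonneDet (n : ℕ) :
    Matrix (Fin n) (Fin n) (PseudoDiffOp K) →* WithZero (Kˣ × Multiplicative ℤ) :=
  (DieudonneDet.existsUnique (PseudoDiffOp.leadingTerm (K := K)) n).choose

lemma dieudonneDet_triangular (T : Matrix (Fin n) (Fin n) (PseudoDiffOp K))
    (hT : ∀ i j, j < i → T i j = 0) :
    dieudonneDet n T = ∏ i, PseudoDiffOp.leadingTerm (T i i) :=
  (DieudonneDet.existsUnique (PseudoDiffOp.leadingTerm (K := K)) n).choose_spec.1 T hT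

lemma rowDet_dieudonneDet :
    DieudonneDet.RowDet (PseudoDiffOp.leadingTerm (K := K)) (dieudonneDet (K := K) n) := by
  have h := DieudonneDet.rowDet_gaussDet (PseudoDiffOp.leadingTerm (K := K)) n
  have e : dieudonneDet (K := K) n = ⟨⟨DieudonneDet.gaussDet _ n, h.one⟩, h.mul⟩ :=
    (DieudonneDet.existsUnique (PseudoDiffOp.leadingTerm (K := K)) n).unique
      dieudonneDet_triangular (DieudonneDet.gaussDet_triangular _ n)
  rw [e]
  exact h

namespace MatDiffOp

/-- The Dieudonné determinant of a matrix differential operator. -/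
noncomputable def det (A : Matrix (Fin n) (Fin n) (DiffOp K)) :
    WithZero (Kˣ × Multiplicative ℤ) :=
  dieudonneDet n (A.map (DiffOp K).subtype)

/-- A matrix differential operator is non-degenerate if its Dieudonné determinant is nonzero. -/
def Nondegenerate (A : Matrix (Fin n) (Fin n) (DiffOp K)) : Prop := det A ≠ 0

/-- The degree `d(A)` of `det A = det₁(A) λ^d(A)`, for non-degenerate `A` (and `0` otherwise). -/
noncomputable def degree (A : Matrix (Fin n) (Fin n) (DiffOp K)) : ℤ :=
  open Classical in if h : det A = 0 then 0 else (WithZero.unzero h).2.toAdd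

/-- The kernel in `Kⁿ` of a matrix differential operator. -/
def ker (A : Matrix (Fin n) (Fin n) (DiffOp K)) : Set (Fin n → K) :=
  {f | ∀ i, ∑ j, DiffOp.eval (A i j) (f j) = 0}

/-- A matrix differential operator, as an element of `Mₙ(K(∂))`. -/
noncomputable def toRat (A : Matrix (Fin n) (Fin n) (DiffOp K)) :
    Matrix (Fin n) (Fin n) (RatPseudoDiffOp K) :=
  A.map DiffOp.toRat

/-- A non-degenerate matrix differential operator is invertible in `Mₙ(K(∂))`. -/
lemma Nondegenerate.isUnit_toRat {B : Matrix (Fin n) (Fin n) (DiffOp K)} (hB : Nondegenerate B) :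
    IsUnit (toRat B) := by
  obtain ⟨M, hM⟩ : ∃ M, M = toRat B := ⟨_, rfl⟩
  let f : (Fin n → RatPseudoDiffOp K) →ₗ[RatPseudoDiffOp K] (Fin n → RatPseudoDiffOp K) :=
    { toFun := fun v => Matrix.vecMul v M
      map_add' := fun v w => Matrix.add_vecMul M v w
      map_smul' := fun a v => Matrix.smul_vecMul a v M }
  have hker : ∀ v, Matrix.vecMul v M = 0 → v = 0 := by
    intro v hv
    by_contra hne
    refine hB (rowDet_dieudonneDet.singular _ (fun k => (v k : PseudoDiffOp K)) ?_ ?_)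
    · intro h0
      exact hne (funext fun k => Subtype.ext (congrFun h0 k))
    · funext j
      have h1 := congrArg (Subtype.val) (congrFun hv j)
      rw [hM] at h1
      simp only [Matrix.vecMul, dotProduct, toRat, Matrix.map_apply, Pi.zero_apply,
        AddSubmonoidClass.coe_finsetSum, MulMemClass.coe_mul, ZeroMemClass.coe_zero] at h1
      simp only [Finset.sum_apply, Pi.smul_apply, smul_eq_mul, Matrix.map_apply, Pi.zero_apply]
      exact h1
  have hinj : Function.Injective f := by
    rw [← LinearMap.ker_eq_bot, LinearMap.ker_eq_bot']
    exact hker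
  have hsurj : Function.Surjective f := LinearMap.injective_iff_surjective.mp hinj
  choose g hg using hsurj
  have hNM : (Matrix.of fun i => g ((1 : Matrix (Fin n) (Fin n) (RatPseudoDiffOp K)) i)) * M = 1 :=
    funext fun i => hg _
  rw [← hM]
  refine ⟨⟨M, _, ?_, hNM⟩, rfl⟩
  rw [← sub_eq_zero]
  have h0 : (M * (Matrix.of fun i => g ((1 : Matrix (Fin n) (Fin n) (RatPseudoDiffOp K)) i)) - 1) *
      M = 0 := by
    rw [sub_mul, mul_assoc, hNM, mul_one, one_mul, sub_self]
  funext i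
  exact hker _ (congrFun h0 i)

/-- `H = A B⁻¹` is a right fractional decomposition of `H ∈ Mₙ(K(∂))`: the matrix differential
operator `B` is non-degenerate, and `H` is the product of `A` and the inverse of `B` in the ring
`Mₙ(K(∂))`. -/
def IsFraction (H : Matrix (Fin n) (Fin n) (RatPseudoDiffOp K))
    (A B : Matrix (Fin n) (Fin n) (DiffOp K)) : Prop :=
  Nondegenerate B ∧ H = toRat A * Ring.inverse (toRat B)

/-- `H = A B⁻¹` is a minimal fractional decomposition: `d(B)` is minimal among all right
fractional decompositions of `H`. -/
def IsMinimalFraction (H : Matrix (Fin n) (Fin n) (RatPseudoDiffOp K))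
    (A B : Matrix (Fin n) (Fin n) (DiffOp K)) : Prop :=
  IsFraction H A B ∧ ∀ C D, IsFraction H C D → degree B ≤ degree D

/-- `A` and `B` are (right) coprime: every common right divisor is invertible in `Mₙ(K[∂])`. -/
def Coprime (A B : Matrix (Fin n) (Fin n) (DiffOp K)) : Prop :=
  ∀ A₁ B₁ D : Matrix (Fin n) (Fin n) (DiffOp K), A = A₁ * D → B = B₁ * D → IsUnit D

end MatDiffOp

/-- A differential field is linearly closed if every homogeneous linear differential equation
`aₙ u⁽ⁿ⁾ + ⋯ + a₁ u' + a₀ u = 0` of order `n ≥ 1` over it has a nonzero solution in it. -/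
def LinearlyClosed (K : Type*) [Field K] [Differential K] : Prop :=
  ∀ (n : ℕ) (a : ℕ → K), 1 ≤ n → a n ≠ 0 →
    ∃ u : K, u ≠ 0 ∧ ∑ i ∈ Finset.range (n + 1), a i * PseudoDiffOp.iterDeriv i u = 0

end Fractions

/-! Everything rests on the fact that `K[∂]` is a Euclidean domain on both sides: the order of
operators is additive and leading coefficients multiply in the field `K`, so division with remainder
works from the left and from the right.

Division with remainder has three consequences. The right Ore condition shows that every element of
`K(∂)` has a right denominator (`exists_mul_mem`), so every `H` is a fraction with scalar
denominator `b · 1`. Left ideals are principal, so every submodule of `K[∂]ⁿ` has `n` generators;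
applied to the span of the rows of `A` and `B`, this gives a greatest common right divisor `A = A₁
D`, `B = B₁ D`, `D = X A + Y B` (`exists_gcd`). Row reduction to triangular form shows that `d(D) ≥
0` for non-degenerate `D`, and that `d(D) = 0` forces `D` to be invertible
(`degree_nonneg_and_isUnit`).

The pivot is the Bézout identity `X A + Y B = 1`, which follows from coprimality by inverting the
greatest common right divisor. It makes the common kernel trivial, because `f = X(A f) + Y(B f)`.
Multiplied by `B⁻¹` it reads `B⁻¹ = X H + Y`; hence for any other fraction `H = C E⁻¹` one gets `E =
B (X C + Y E)` and `C = H E = A (X C + Y E)`, which is (c). Since `d` is additive and nonnegative,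
this also makes `d(B)` minimal. Conversely, a common right factor `D` of a fraction with minimal
`d(B)` has `d(D) ≤ 0` and is invertible. For (a), divide any fraction by its greatest common right
divisor `D` and cancel `D` in the Bézout relation.

Linear closedness enters in passing from trivial common kernel to coprimality: a non-degenerate `D`
with zero kernel is invertible (`isUnit_of_ker`). If its rows span a proper submodule, enlarge this
to a maximal one `M`. The quotient is simple, isomorphic to `K[∂]/K[∂]p` with `p` not a unit, and a
nonzero solution `u` of `p(u) = 0` defines a nonzero homomorphism from `K[∂]ⁿ/M` to `K`. The images
of the basis vectors form a nonzero `f` with `D f = 0` (`exists_common_solution`). -/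

namespace DiffOp

variable {K : Type*} [Field K] [Differential K]

open PseudoDiffOp

/-! ### Euclidean division in `K[∂]`, the Ore condition and denominators. -/

lemma exists_natBound (P : DiffOp K) : ∃ N : ℕ, ∀ m : ℤ, N ≤ m → (P : PseudoDiffOp K).coeff m = 0 := by
  obtain ⟨N, hN0, hN⟩ := (P : PseudoDiffOp K).exists_bound
  exact ⟨(N + 1).toNat, fun m hm => hN m (by omega)⟩

open Classical in
/-- The least `N` such that all coefficients of `∂ᵐ`, `m ≥ N`, vanish: the order plus one for a
nonzero operator, and `0` for the zero operator. -/
noncomputable def size (P : DiffOp K) : ℕ := Nat.find (exists_natBound P)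

lemma coeff_eq_zero_of_size_le {P : DiffOp K} {m : ℤ} (h : size P ≤ m) :
    (P : PseudoDiffOp K).coeff m = 0 := by
  classical
  exact Nat.find_spec (exists_natBound P) m h

lemma size_le {P : DiffOp K} {N : ℕ} (h : ∀ m : ℤ, N ≤ m → (P : PseudoDiffOp K).coeff m = 0) :
    size P ≤ N := by
  classical
  exact Nat.find_min' (exists_natBound P) h

lemma size_eq_zero {P : DiffOp K} : size P = 0 ↔ P = 0 := by
  constructor
  · intro h
    ext m
    rcases lt_or_ge m 0 with hm | hm
    · exact P.2 m hm
    · exact coeff_eq_zero_of_size_le (by omega)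
  · rintro rfl
    exact Nat.le_zero.mp (size_le fun _ _ => rfl)

lemma coeff_ne_zero_of_size {P : DiffOp K} {d : ℕ} (h : size P = d + 1) :
    (P : PseudoDiffOp K).coeff d ≠ 0 := by
  intro h0
  have : size P ≤ d := size_le fun m hm => by
    rcases hm.eq_or_lt with rfl | hm
    · exact h0
    · exact coeff_eq_zero_of_size_le (by omega)
  omega

lemma size_lt_of_coeff {P : DiffOp K} {d : ℕ}
    (h : ∀ m : ℤ, d ≤ m → (P : PseudoDiffOp K).coeff m = 0) : size P < d + 1 :=
  Nat.lt_succ_of_le (size_le h)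

/-- The differential operator `a ∂ᵐ`. -/
noncomputable def mono (m : ℕ) (a : K) : DiffOp K :=
  ⟨monomial m a, fun k hk => if_neg (by omega)⟩

lemma coeff_mono (m : ℕ) (a : K) (k : ℤ) :
    (mono m a : PseudoDiffOp K).coeff k = if k = m then a else 0 := rfl

lemma coeff_sub (P Q : DiffOp K) (m : ℤ) : ((P - Q : DiffOp K) : PseudoDiffOp K).coeff m =
    (P : PseudoDiffOp K).coeff m - (Q : PseudoDiffOp K).coeff m := by
  rw [sub_eq_add_neg, sub_eq_add_neg]; rfl

/-- The sizes are only bounded from above, so the formula applies to a monomial without checking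
that its coefficient is nonzero. -/
lemma coeff_mul_top (P Q : DiffOp K) {d e : ℕ} (hP : size P ≤ d + 1) (hQ : size Q ≤ e + 1) :
    ((P * Q : DiffOp K) : PseudoDiffOp K).coeff (d + e) =
      (P : PseudoDiffOp K).coeff d * (Q : PseudoDiffOp K).coeff e :=
  mul_coeff_top _ _ (fun m hm => coeff_eq_zero_of_size_le (by omega))
    (fun m hm => coeff_eq_zero_of_size_le (by omega))

lemma coeff_mul_of_lt (P Q : DiffOp K) {d e : ℕ} (hP : size P ≤ d + 1) (hQ : size Q ≤ e + 1)
    {m : ℤ} (hm : d + e < m) : ((P * Q : DiffOp K) : PseudoDiffOp K).coeff m = 0 :=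
  mulCoeff_eq_zero _ _ (N₁ := d) (N₂ := e) (fun m hm => coeff_eq_zero_of_size_le (by omega))
    (fun m hm => coeff_eq_zero_of_size_le (by omega)) hm

lemma size_mono_le (m : ℕ) (a : K) : size (mono m a) ≤ m + 1 :=
  size_le fun k hk => by rw [coeff_mono, if_neg (by push_cast at hk; omega)]

/-- Since `K` is commutative, `q * b` and `b * q` have the same leading coefficient when `q` is a
monomial. So one monomial, the quotient of the leading terms of `a` and `b`, serves on both sides.
-/
lemma exists_sub_mul_size_lt {a b : DiffOp K} (hb : b ≠ 0) (hab : size b ≤ size a) :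
    (∃ q, size (a - q * b) < size a) ∧ ∃ q, size (a - b * q) < size a := by
  obtain ⟨e, he⟩ := Nat.exists_eq_succ_of_ne_zero (fun h => hb (size_eq_zero.mp h))
  obtain ⟨d, hd⟩ := Nat.exists_eq_succ_of_ne_zero (show (size a) ≠ 0 by omega)
  obtain ⟨k, rfl⟩ := Nat.exists_eq_add_of_le (show e ≤ d by omega)
  have hb' : (b : PseudoDiffOp K).coeff e ≠ 0 := coeff_ne_zero_of_size he
  obtain ⟨c, hc⟩ : ∃ c, c = (a : PseudoDiffOp K).coeff (e + k : ℕ) / (b : PseudoDiffOp K).coeff e :=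
    ⟨_, rfl⟩
  have hc' : c * (b : PseudoDiffOp K).coeff e = (a : PseudoDiffOp K).coeff (e + k : ℕ) := by
    rw [hc, div_mul_cancel₀ _ hb']
  rw [hd]
  constructor
  · refine ⟨mono k c, size_lt_of_coeff fun m hm => ?_⟩
    rw [coeff_sub]
    rcases hm.eq_or_lt with rfl | hm
    · have := coeff_mul_top (mono k c) b (size_mono_le k c) he.le
      rw [coeff_mono, if_pos rfl, hc', ← Nat.cast_add, add_comm k] at this
      rw [this, sub_self]
    · rw [coeff_mul_of_lt _ _ (size_mono_le k c) he.le (by push_cast at hm; omega),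
        coeff_eq_zero_of_size_le (by omega), sub_self]
  · refine ⟨mono k c, size_lt_of_coeff fun m hm => ?_⟩
    rw [coeff_sub]
    rcases hm.eq_or_lt with rfl | hm
    · have := coeff_mul_top b (mono k c) he.le (size_mono_le k c)
      rw [coeff_mono, if_pos rfl, mul_comm, hc', ← Nat.cast_add] at this
      rw [this, sub_self]
    · rw [coeff_mul_of_lt _ _ he.le (size_mono_le k c) (by push_cast at hm; omega),
        coeff_eq_zero_of_size_le (by omega), sub_self]

lemma exists_sub_mul_right_size_lt (a : DiffOp K) {b : DiffOp K} (hb : b ≠ 0) :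
    ∃ q, size (a - q * b) < size b := by
  induction h : size a using Nat.strong_induction_on generalizing a with
  | _ s ih =>
    subst h
    by_cases hab : size b ≤ size a
    · obtain ⟨q, hq⟩ := (exists_sub_mul_size_lt hb hab).1
      obtain ⟨q', hq'⟩ := ih _ hq _ rfl
      exact ⟨q + q', by rwa [add_mul, ← sub_sub]⟩
    · exact ⟨0, by rw [zero_mul, sub_zero]; omega⟩

lemma exists_sub_mul_left_size_lt (a : DiffOp K) {b : DiffOp K} (hb : b ≠ 0) :
    ∃ q, size (a - b * q) < size b := by
  induction h : size a using Nat.strong_induction_on generalizing a with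
  | _ s ih =>
    subst h
    by_cases hab : size b ≤ size a
    · obtain ⟨q, hq⟩ := (exists_sub_mul_size_lt hb hab).2
      obtain ⟨q', hq'⟩ := ih _ hq _ rfl
      exact ⟨q + q', by rwa [mul_add, ← sub_sub]⟩
    · exact ⟨0, by rw [mul_zero, sub_zero]; omega⟩

/-- Every left ideal of `K[∂]` is principal. -/
lemma exists_generator (I : Ideal (DiffOp K)) : ∃ d ∈ I, ∀ a ∈ I, ∃ q, a = q * d := by
  classical
  by_cases hI : ∃ s, ∃ a ∈ I, a ≠ 0 ∧ size a = s
  · obtain ⟨d, hd, hd0, hs⟩ := Nat.find_spec hI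
    refine ⟨d, hd, fun a ha => ?_⟩
    obtain ⟨q, hq⟩ := exists_sub_mul_right_size_lt a hd0
    refine ⟨q, sub_eq_zero.mp (by_contra fun h0 => ?_)⟩
    exact Nat.find_min hI (hs ▸ hq) ⟨_, I.sub_mem ha (I.mul_mem_left q hd), h0, rfl⟩
  · push Not at hI
    refine ⟨0, I.zero_mem, fun a ha => ⟨0, ?_⟩⟩
    rw [zero_mul]
    by_contra h0
    exact hI _ a ha h0 rfl

/-- The right Ore condition. -/
lemma exists_mul_eq_mul (a : DiffOp K) {b : DiffOp K} (hb : b ≠ 0) :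
    ∃ c d, c ≠ 0 ∧ a * c = b * d := by
  induction h : size b using Nat.strong_induction_on generalizing a b with
  | _ s ih =>
    subst h
    obtain ⟨q, hq⟩ := exists_sub_mul_left_size_lt a hb
    by_cases hr : a - b * q = 0
    · exact ⟨1, q, one_ne_zero, by rw [mul_one, ← sub_eq_zero, hr]⟩
    · obtain ⟨c, d, hc, hcd⟩ := ih _ hq b hr rfl
      -- With remainder `r = a - b q`, the smaller pair gives `b c = r d`, whence `a d = b q d + r d
      -- = b (q d + c)`. If `d` were zero, `b c` would vanish with both factors nonzero.
      refine ⟨d, q * d + c, ?_, ?_⟩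
      · rintro rfl
        rw [mul_zero] at hcd
        exact mul_ne_zero hb hc hcd
      · rw [mul_add, hcd, sub_mul, mul_assoc]; abel

/-- The elements with a right denominator form a subfield. Sums and products use a common right
multiple from the Ore condition; for the inverse of `x ≠ 0` the numerator `x * b` becomes the
denominator. -/
lemma exists_mul_mem (h : PseudoDiffOp K) (hh : h ∈ RatPseudoDiffOp K) :
    ∃ b ∈ DiffOp K, b ≠ 0 ∧ h * b ∈ DiffOp K := by
  have ore : ∀ a ∈ DiffOp K, ∀ b ∈ DiffOp K, b ≠ 0 →
      ∃ c ∈ DiffOp K, ∃ d ∈ DiffOp K, c ≠ 0 ∧ a * c = b * d := by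
    intro a ha b hb hb0
    obtain ⟨c, d, hc, hcd⟩ := exists_mul_eq_mul (⟨a, ha⟩ : DiffOp K) (b := ⟨b, hb⟩)
      (fun h => hb0 (congrArg Subtype.val h))
    exact ⟨c, c.2, d, d.2, fun h => hc (Subtype.ext h), congrArg Subtype.val hcd⟩
  refine Subfield.closure_induction (p := fun h _ => ∃ b ∈ DiffOp K, b ≠ 0 ∧ h * b ∈ DiffOp K)
    ?_ ?_ ?_ ?_ ?_ ?_ hh
  · exact fun x hx => ⟨1, one_mem _, one_ne_zero, by rw [mul_one]; exact hx⟩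
  · exact ⟨1, one_mem _, one_ne_zero, by rw [mul_one]; exact one_mem _⟩
  · rintro x y - - ⟨b, hb, hb0, hxb⟩ ⟨b', hb', hb0', hyb⟩
    obtain ⟨c, hc, d, hd, hc0, hcd⟩ := ore b hb b' hb' hb0'
    refine ⟨b * c, mul_mem hb hc, mul_ne_zero hb0 hc0, ?_⟩
    rw [add_mul, ← mul_assoc, hcd, ← mul_assoc]
    exact add_mem (mul_mem hxb hc) (mul_mem hyb hd)
  · rintro x - ⟨b, hb, hb0, hxb⟩
    exact ⟨b, hb, hb0, by rw [neg_mul]; exact neg_mem hxb⟩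
  · rintro x - ⟨b, hb, hb0, hxb⟩
    by_cases hx : x = 0
    · exact ⟨1, one_mem _, one_ne_zero, by rw [hx, inv_zero, zero_mul]; exact zero_mem _⟩
    · exact ⟨x * b, hxb, mul_ne_zero hx hb0, by rwa [inv_mul_cancel_left₀ hx]⟩
  · rintro x y - - ⟨b, hb, hb0, hxb⟩ ⟨b', hb', hb0', hyb⟩
    obtain ⟨c, hc, d, hd, hc0, hcd⟩ := ore (y * b') hyb b hb hb0
    refine ⟨b' * c, mul_mem hb' hc, mul_ne_zero hb0' hc0, ?_⟩
    rw [mul_assoc, ← mul_assoc y, hcd, ← mul_assoc]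
    exact mul_mem hxb hd

lemma toRat_injective : Function.Injective (toRat : DiffOp K →+* RatPseudoDiffOp K) :=
  Subring.inclusion_injective _

/-- Finitely many elements of `K(∂)` have a common right denominator. -/
lemma exists_common_denominator {ι : Type*} (s : Finset ι) (h : ι → RatPseudoDiffOp K) :
    ∃ b : DiffOp K, b ≠ 0 ∧ ∀ i ∈ s, ∃ a : DiffOp K, h i * toRat b = toRat a := by
  classical
  induction s using Finset.induction_on with
  | empty => exact ⟨1, one_ne_zero, by simp⟩
  | insert i s hi ih =>
    obtain ⟨b, hb, hs⟩ := ih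
    -- The denominator is taken for `h i * b` instead of `h i`, so that `b * c` still serves the
    -- earlier elements.
    obtain ⟨c, hc, hc0, hic⟩ := exists_mul_mem _ (h i * toRat b).2
    refine ⟨b * ⟨c, hc⟩, mul_ne_zero hb fun h0 => hc0 (congrArg Subtype.val h0), ?_⟩
    intro j hj
    rw [map_mul, ← mul_assoc]
    rcases Finset.mem_insert.mp hj with rfl | hj
    · exact ⟨⟨_, hic⟩, rfl⟩
    · obtain ⟨a, ha⟩ := hs j hj
      exact ⟨a * ⟨c, hc⟩, by rw [ha, map_mul]⟩

end DiffOp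

/-! ### The action of `K[∂]` on `K`. -/

namespace DiffOp

variable {K : Type*} [Field K] [Differential K]

open PseudoDiffOp

lemma eval_eq_sum (P : DiffOp K) (f : K) {N : ℕ} (hN : size P ≤ N) :
    eval P f = ∑ k ∈ Finset.range N, (P : PseudoDiffOp K).coeff k * iterDeriv k f := by
  refine finsum_eq_sum_of_support_subset _ fun k hk => ?_
  rw [Finset.coe_range, Set.mem_Iio]
  by_contra hc
  exact hk (by simp only; rw [coeff_eq_zero_of_size_le (by omega), zero_mul])

lemma eval_add (P Q : DiffOp K) (f : K) : eval (P + Q) f = eval P f + eval Q f := by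
  have hs : size (P + Q) ≤ max (size P) (size Q) := size_le fun m hm => by
    change (P : PseudoDiffOp K).coeff m + (Q : PseudoDiffOp K).coeff m = 0
    rw [coeff_eq_zero_of_size_le (by omega), coeff_eq_zero_of_size_le (by omega), add_zero]
  rw [eval_eq_sum _ f hs, eval_eq_sum P f (le_max_left _ _), eval_eq_sum Q f (le_max_right _ _),
    ← Finset.sum_add_distrib]
  exact Finset.sum_congr rfl fun k _ => add_mul _ _ _

lemma eval_add_right (P : DiffOp K) (f g : K) : eval P (f + g) = eval P f + eval P g := by
  simp only [eval_eq_sum P _ le_rfl, iterDeriv_add, mul_add, Finset.sum_add_distrib]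

lemma eval_zero_right (P : DiffOp K) : eval P 0 = 0 := by
  simp [eval_eq_sum P _ le_rfl]

lemma eval_mono (m : ℕ) (a f : K) : eval (mono m a) f = a * iterDeriv m f := by
  rw [eval_eq_sum _ f (size_mono_le m a), Finset.sum_eq_single m]
  · rw [coeff_mono, if_pos rfl]
  · intro k _ hk
    rw [coeff_mono, if_neg (by exact_mod_cast hk), zero_mul]
  · intro h
    exact absurd (Finset.mem_range.mpr (Nat.lt_succ_self m)) h

lemma mono_zero_one : (mono 0 1 : DiffOp K) = 1 := rfl

lemma eval_one (f : K) : eval (1 : DiffOp K) f = f := by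
  rw [← mono_zero_one, eval_mono, one_mul, iterDeriv_zero]

lemma coeff_mono_zero_mul (a : K) (P : DiffOp K) (r : ℤ) :
    ((mono 0 a * P : DiffOp K) : PseudoDiffOp K).coeff r = a * (P : PseudoDiffOp K).coeff r :=
  monomial_zero_mul_coeff a P r

/-- This is `∂ ∘ b = b ∂ + b'` on coefficients: in the product formula `binom(1, s)` vanishes for `s
≥ 2`, so only two index pairs contribute. -/
lemma coeff_deriv_mul (P : DiffOp K) (r : ℤ) :
    ((mono 1 1 * P : DiffOp K) : PseudoDiffOp K).coeff r =
      (P : PseudoDiffOp K).coeff (r - 1) + iterDeriv 1 ((P : PseudoDiffOp K).coeff r) := by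
  change mulCoeff (monomial 1 1) _ r = _
  rw [mulCoeff, finsum_eq_sum_of_support_subset (s := {((1 : ℤ), r - 1), (1, r)})]
  · rw [Finset.sum_pair (by simp)]
    have h0 : (1 : ℤ) + (r - 1) - r = (0 : ℕ) := by push_cast; ring
    have h1 : (1 : ℤ) + r - r = (1 : ℕ) := by push_cast; ring
    simp only [h0, h1, mulTerm_natCast]
    simp [monomial]
  · rintro ⟨m, n⟩ h
    rw [Function.mem_support] at h
    by_cases hm : m = 1
    · subst hm
      have hs : 0 ≤ 1 + n - r := by
        by_contra hc
        exact h (mulTerm_of_neg (not_le.mp hc) _ _)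
      obtain ⟨s, hs⟩ := Int.eq_ofNat_of_zero_le hs
      have hs1 : s ≤ 1 := by
        by_contra hc
        refine h ?_
        simp only [hs, mulTerm_natCast]
        rw [show (1 : ℤ) = ((1 : ℕ) : ℤ) from rfl, Ring.choose_natCast,
          Nat.choose_eq_zero_of_lt (by omega)]
        simp
      have hn : n = r - 1 ∨ n = r := by
        have hs' : 1 + n - r = s := hs
        omega
      rcases hn with rfl | rfl <;> simp
    · exact absurd (by simp [monomial, hm]) h

lemma mono_eq (m : ℕ) (a : K) : mono m a = mono 0 a * mono 1 1 ^ m := by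
  have h1 : ∀ m : ℕ, (mono 1 1 : DiffOp K) ^ m = mono m 1 := by
    intro m
    induction m with
    | zero => rw [pow_zero, mono_zero_one]
    | succ m ih =>
      rw [pow_succ', ih]
      ext r
      rw [coeff_deriv_mul, coeff_mono, coeff_mono, coeff_mono]
      have h0 : iterDeriv 1 (if r = m then (1 : K) else 0) = 0 := by
        split_ifs
        · exact iterDeriv_one 1 one_ne_zero
        · exact iterDeriv_zero_right 1
      rw [h0, add_zero]
      refine if_congr ?_ rfl rfl
      push_cast; omega
  ext r
  rw [h1, coeff_mono_zero_mul, coeff_mono, coeff_mono]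
  split_ifs <;> simp

/-- Induction for differential operators: `K[∂]` is generated by `K` and `∂`. -/
lemma generation {p : DiffOp K → Prop} (hc : ∀ a, p (mono 0 a)) (hd : p (mono 1 1))
    (hadd : ∀ P Q, p P → p Q → p (P + Q)) (hmul : ∀ P Q, p P → p Q → p (P * Q))
    (P : DiffOp K) : p P := by
  have hpow : ∀ m : ℕ, p (mono 1 1 ^ m) := by
    intro m
    induction m with
    | zero => rw [pow_zero, ← mono_zero_one]; exact hc 1
    | succ m ih => rw [pow_succ']; exact hmul _ _ hd ih
  have hzero : p 0 := by
    have : (0 : DiffOp K) = mono 0 0 := by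
      ext r; rw [coeff_mono, ite_self]; rfl
    rw [this]; exact hc 0
  have hP : P = ∑ k ∈ Finset.range (size P), mono k ((P : PseudoDiffOp K).coeff k) := by
    have hcoe : ∀ (s : Finset ℕ) (g : ℕ → DiffOp K) (r : ℤ),
        ((∑ k ∈ s, g k : DiffOp K) : PseudoDiffOp K).coeff r =
          ∑ k ∈ s, (g k : PseudoDiffOp K).coeff r := by
      intro s g r
      classical
      induction s using Finset.induction_on with
      | empty => simp
      | insert i s hi ih =>
        rw [Finset.sum_insert hi, Finset.sum_insert hi, ← ih]; rfl
    ext r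
    rw [hcoe]
    simp only [coeff_mono]
    rcases lt_or_ge r 0 with hr | hr
    · rw [P.2 r hr, Finset.sum_eq_zero fun k _ => if_neg (by omega)]
    · obtain ⟨k, rfl⟩ := Int.eq_ofNat_of_zero_le hr
      simp only [Nat.cast_inj, Finset.sum_ite_eq, Finset.mem_range]
      split_ifs with hk
      · rfl
      · exact coeff_eq_zero_of_size_le (by omega)
  rw [hP]
  exact Finset.sum_induction _ p hadd hzero fun k _ => by
    rw [mono_eq]; exact hmul _ _ (hc _) (hpow k)

/-- Compatibility with products is preserved by sums and products of the left factor, so it need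
only be checked for constants and for `∂`, where it is the Leibniz rule. -/
lemma eval_mul (P Q : DiffOp K) (f : K) : eval (P * Q) f = eval P (eval Q f) := by
  revert Q f
  refine generation (p := fun P => ∀ (Q : DiffOp K) f, eval (P * Q) f = eval P (eval Q f))
    ?_ ?_ ?_ ?_ P
  · intro a Q f
    have hs : size (mono 0 a * Q) ≤ size Q := size_le fun m hm => by
      rw [coeff_mono_zero_mul, coeff_eq_zero_of_size_le hm, mul_zero]
    rw [eval_mono, iterDeriv_zero, eval_eq_sum _ f hs, eval_eq_sum Q f le_rfl, Finset.mul_sum]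
    exact Finset.sum_congr rfl fun k _ => by rw [coeff_mono_zero_mul, mul_assoc]
  · intro Q f
    have hs : size (mono 1 1 * Q) ≤ size Q + 1 := size_le fun m hm => by
      rw [coeff_deriv_mul, coeff_eq_zero_of_size_le (by push_cast at hm; omega),
        coeff_eq_zero_of_size_le (by push_cast at hm; omega), iterDeriv_zero_right, add_zero]
    rw [eval_mono, one_mul, eval_eq_sum _ f hs, eval_eq_sum Q f le_rfl, iterDeriv_sum]
    simp only [coeff_deriv_mul, add_mul, Finset.sum_add_distrib]
    -- The shifted sum loses its first term, whose coefficient has index `-1`, and the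
    -- differentiated sum its last term, whose coefficient has index `size Q`. What remains matches
    -- termwise.
    rw [Finset.sum_range_succ', Finset.sum_range_succ (fun k =>
      iterDeriv 1 ((Q : PseudoDiffOp K).coeff k) * iterDeriv k f),
      coeff_eq_zero_of_size_le (le_refl ((size Q) : ℤ)), Q.2 (((0 : ℕ) : ℤ) - 1) (by simp)]
    simp only [iterDeriv_zero_right, zero_mul, add_zero]
    rw [← Finset.sum_add_distrib]
    refine Finset.sum_congr rfl fun k _ => ?_
    rw [show ((k + 1 : ℕ) : ℤ) - 1 = k by push_cast; ring, iterDeriv_succ, iterDeriv_succ,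
      iterDeriv_succ, iterDeriv_zero, iterDeriv_zero, Derivation.leibniz, smul_eq_mul, smul_eq_mul]
    ring
  · intro P P' h h' Q f
    rw [add_mul, eval_add, h, h', eval_add]
  · intro P P' h h' Q f
    rw [mul_assoc, h, h', ← h]

/-- The action of differential operators on `K`, as a ring homomorphism. -/
noncomputable def evalHom : DiffOp K →+* AddMonoid.End K where
  toFun P := ⟨⟨eval P, eval_zero_right P⟩, eval_add_right P⟩
  map_one' := AddMonoidHom.ext eval_one
  map_mul' P Q := AddMonoidHom.ext (eval_mul P Q)
  map_zero' := AddMonoidHom.ext fun f => by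
    have := eval_add (0 : DiffOp K) 0 f
    rw [add_zero] at this
    exact left_eq_add.mp this
  map_add' P Q := AddMonoidHom.ext (eval_add P Q)

@[simp] lemma evalHom_apply (P : DiffOp K) (f : K) : evalHom P f = eval P f := rfl

lemma eval_zero (f : K) : eval (0 : DiffOp K) f = 0 := by
  rw [← evalHom_apply, map_zero]; rfl

lemma eval_sum {ι : Type*} (s : Finset ι) (P : ι → DiffOp K) (f : K) :
    eval (∑ i ∈ s, P i) f = ∑ i ∈ s, eval (P i) f := by
  classical
  induction s using Finset.induction_on with
  | empty => rw [Finset.sum_empty, Finset.sum_empty, eval_zero]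
  | insert i s hi ih => rw [Finset.sum_insert hi, Finset.sum_insert hi, eval_add, ih]

lemma eval_sum_right {ι : Type*} (s : Finset ι) (P : DiffOp K) (f : ι → K) :
    eval P (∑ i ∈ s, f i) = ∑ i ∈ s, eval P (f i) :=
  map_sum (evalHom P) f s

lemma isUnit_of_size_eq_one {P : DiffOp K} (h : size P = 1) : IsUnit P := by
  have h0 : (P : PseudoDiffOp K).coeff (0 : ℕ) ≠ 0 := coeff_ne_zero_of_size h
  have hP : P = mono 0 ((P : PseudoDiffOp K).coeff (0 : ℕ)) := by
    ext m
    rw [coeff_mono]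
    split_ifs with hm
    · rw [hm]
    · rcases lt_or_ge m 0 with hm' | hm'
      · exact P.2 m hm'
      · exact coeff_eq_zero_of_size_le (by push_cast at hm; omega)
  have hm : ∀ a b : K, (mono 0 a * mono 0 b : DiffOp K) = mono 0 (a * b) := by
    intro a b
    ext m
    rw [coeff_mono_zero_mul, coeff_mono, coeff_mono, mul_ite, mul_zero]
  obtain ⟨a, ha⟩ : ∃ a, a = (P : PseudoDiffOp K).coeff (0 : ℕ) := ⟨_, rfl⟩
  rw [← ha] at h0 hP
  rw [hP]
  exact ⟨⟨mono 0 a, mono 0 a⁻¹, by rw [hm, mul_inv_cancel₀ h0, mono_zero_one],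
    by rw [hm, inv_mul_cancel₀ h0, mono_zero_one]⟩, rfl⟩

/-- Over a linearly closed field a non-invertible differential operator has a nonzero solution. -/
lemma exists_eval_eq_zero (hK : LinearlyClosed K) {P : DiffOp K} (hP : ¬ IsUnit P) :
    ∃ u : K, u ≠ 0 ∧ eval P u = 0 := by
  rcases Nat.lt_or_ge (size P) 2 with h | h
  · have h0 : P = 0 := by
      rw [← size_eq_zero]
      by_contra h0
      exact hP (isUnit_of_size_eq_one (by omega))
    exact ⟨1, one_ne_zero, by rw [h0, eval_zero]⟩
  · obtain ⟨d, hd⟩ := Nat.exists_eq_succ_of_ne_zero (show (size P) ≠ 0 by omega)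
    obtain ⟨u, hu, hu0⟩ := hK d (fun i => (P : PseudoDiffOp K).coeff i) (by omega)
      (coeff_ne_zero_of_size hd)
    exact ⟨u, hu, by rw [eval_eq_sum P u hd.le]; exact hu0⟩

end DiffOp

/-! ### Row reduction of matrix differential operators. -/

namespace MatDiffOp

variable {K : Type*} [Field K] [Differential K]

open PseudoDiffOp DiffOp Matrix

/-- Every square matrix of differential operators can be brought to upper triangular form by
adding multiples of rows to other rows. -/
lemma row_reduction : ∀ {n : ℕ} (p : Matrix (Fin n) (Fin n) (DiffOp K) → Prop),
    (∀ T, (∀ i j, j < i → T i j = 0) → p T) →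
    (∀ M i j, i ≠ j → ∀ a : DiffOp K, p (updateRow M i (M i + a • M j)) → p M) → ∀ M, p M := by
  intro n
  induction n with
  | zero => exact fun p ht _ M => ht M fun i => i.elim0
  | succ n ih =>
    intro p ht hop
    -- Freezing the first row embeds the smaller matrices as lower right blocks; row operations on a
    -- block are row operations on the whole matrix, so the induction hypothesis transfers.
    have hblock : ∀ M : Matrix (Fin (n + 1)) (Fin (n + 1)) (DiffOp K),
        (∀ i : Fin n, M i.succ 0 = 0) → p M := by
      intro M hM
      let B : Matrix (Fin n) (Fin n) (DiffOp K) → Matrix (Fin (n + 1)) (Fin (n + 1)) (DiffOp K) :=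
        fun N => Fin.cons (M 0) (fun i => Fin.cons 0 (N i))
      have hBs : ∀ N i, B N (Fin.succ i) = Fin.cons 0 (N i) := fun N i => rfl
      have hupd : ∀ N i v, B (updateRow N i v) = updateRow (B N) i.succ (Fin.cons 0 v) := by
        intro N i v
        funext k
        refine Fin.cases ?_ (fun k => ?_) k
        · rw [updateRow_ne (Fin.succ_ne_zero i).symm]; rfl
        · by_cases hk : k = i
          · subst hk; rw [updateRow_self, hBs, updateRow_self]
          · rw [updateRow_ne (by simpa using hk), hBs, hBs, updateRow_ne hk]
      have key : ∀ N, p (B N) := by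
        refine ih (fun N => p (B N)) ?_ ?_
        · intro T hT
          refine ht _ fun i j hij => ?_
          obtain ⟨i, rfl⟩ := Fin.exists_succ_eq.mpr (Fin.ne_zero_of_lt hij)
          rw [hBs]
          revert hij
          refine Fin.cases (fun _ => rfl) (fun j hij => ?_) j
          exact hT i j (Fin.succ_lt_succ_iff.mp hij)
        · intro N i j hij a hN
          refine hop _ i.succ j.succ (by simpa using hij) a ?_
          rw [hupd] at hN
          convert hN using 2
          rw [hBs, hBs]
          funext k
          refine Fin.cases ?_ (fun k => ?_) k <;> simp
      have hMB : M = B (fun i j => M i.succ j.succ) := by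
        funext i
        refine Fin.cases rfl (fun i => ?_) i
        refine Eq.trans ?_ (hBs _ i).symm
        funext j
        refine Fin.cases ?_ (fun j => ?_) j
        · simpa using hM i
        · simp
      rw [hMB]
      exact key _
    intro M
    -- Euclid's algorithm in the first column: each division step lowers the total size of its
    -- entries.
    induction h : ∑ i, size (M i 0) using Nat.strong_induction_on generalizing M with
    | _ s ihs =>
      subst h
      by_cases hex : ∃ i j, i ≠ j ∧ M j 0 ≠ 0 ∧ size (M j 0) ≤ size (M i 0)
      · obtain ⟨i, j, hij, hj, hs⟩ := hex
        obtain ⟨q, hq⟩ := (exists_sub_mul_size_lt hj hs).1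
        refine hop M i j hij (-q) (ihs _ ?_ _ rfl)
        refine Finset.sum_lt_sum (fun k _ => ?_) ⟨i, Finset.mem_univ i, ?_⟩
        · by_cases hk : k = i
          · subst hk
            rw [updateRow_self]
            simpa [sub_eq_add_neg] using hq.le
          · rw [updateRow_ne hk]
        · rw [updateRow_self]
          simpa [sub_eq_add_neg] using hq
      · push Not at hex
        -- When no division is possible, two nonzero entries would each be strictly smaller than the
        -- other, so at most one is nonzero.
        have hone : ∀ i j, i ≠ j → M i 0 ≠ 0 → M j 0 = 0 := by
          intro i j hij hi
          by_contra hj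
          have h1 := hex i j hij hj
          have h2 := hex j i hij.symm hi
          omega
        by_cases h0 : M 0 0 = 0
        · by_cases hi : ∃ i : Fin n, M i.succ 0 ≠ 0
          · obtain ⟨i, hi⟩ := hi
            -- The surviving entry is copied to the top by adding row `i.succ` to row `0`, then
            -- cleared below by subtraction. Swaps are avoided, so only row additions, which
            -- preserve the determinant, occur.
            refine hop M 0 i.succ (Fin.succ_ne_zero i).symm 1
              (hop _ i.succ 0 (Fin.succ_ne_zero i) (-1) (hblock _ fun k => ?_))
            by_cases hk : k = i
            · subst hk
              simp [h0]
            · rw [updateRow_ne (by simpa using hk), updateRow_ne (Fin.succ_ne_zero k)]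
              exact hone i.succ k.succ (by simpa using Ne.symm hk) hi
          · push Not at hi
            exact hblock M hi
        · exact hblock M fun i => hone 0 i.succ (Fin.succ_ne_zero i).symm h0

variable {n : ℕ}

/-! ### Determinant, degree and invertibility. -/

lemma toRat_mul (A B : Matrix (Fin n) (Fin n) (DiffOp K)) : toRat (A * B) = toRat A * toRat B :=
  Matrix.map_mul

lemma toRat_add (A B : Matrix (Fin n) (Fin n) (DiffOp K)) : toRat (A + B) = toRat A + toRat B :=
  Matrix.map_add _ (map_add _) _ _

lemma toRat_one : toRat (1 : Matrix (Fin n) (Fin n) (DiffOp K)) = 1 :=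
  Matrix.map_one _ (map_zero _) (map_one _)

lemma toRat_injective :
    Function.Injective (toRat : Matrix (Fin n) (Fin n) (DiffOp K) → _) :=
  Matrix.map_injective DiffOp.toRat_injective

lemma det_mul (A B : Matrix (Fin n) (Fin n) (DiffOp K)) : det (A * B) = det A * det B := by
  rw [det, Matrix.map_mul, map_mul]; rfl

lemma nondegenerate_mul {A B : Matrix (Fin n) (Fin n) (DiffOp K)} :
    Nondegenerate (A * B) ↔ Nondegenerate A ∧ Nondegenerate B := by
  rw [Nondegenerate, det_mul, mul_ne_zero_iff]; rfl

lemma degree_eq {A : Matrix (Fin n) (Fin n) (DiffOp K)} {x : Kˣ × Multiplicative ℤ}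
    (h : det A = x) : degree A = x.2.toAdd := by
  rw [degree, dif_neg (by rw [h]; exact WithZero.coe_ne_zero)]
  congr
  rw [← WithZero.coe_inj, WithZero.coe_unzero, h]

lemma degree_mul {A B : Matrix (Fin n) (Fin n) (DiffOp K)} (hA : Nondegenerate A)
    (hB : Nondegenerate B) : degree (A * B) = degree A + degree B := by
  obtain ⟨x, hx⟩ := WithZero.ne_zero_iff_exists.mp hA
  obtain ⟨y, hy⟩ := WithZero.ne_zero_iff_exists.mp hB
  rw [degree_eq hx.symm, degree_eq hy.symm, degree_eq (x := x * y)]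
  · rfl
  · rw [det_mul, ← hx, ← hy, WithZero.coe_mul]

lemma det_updateRow_add (M : Matrix (Fin n) (Fin n) (DiffOp K)) {i j : Fin n} (hij : i ≠ j)
    (a : DiffOp K) : det (updateRow M i (M i + a • M j)) = det M := by
  refine Eq.trans (congrArg (dieudonneDet n) ?_)
    (rowDet_dieudonneDet.add (M.map (DiffOp K).subtype) i j hij (a : PseudoDiffOp K))
  funext k
  by_cases hk : k = i
  · subst hk
    funext l
    simp
  · funext l
    simp [updateRow_ne hk]

/-- The cancellation takes place in `Mₙ(K(∂))`, where `B` is invertible; the inclusion of `Mₙ(K[∂])`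
is injective. -/
lemma Nondegenerate.mul_left_cancel {B : Matrix (Fin n) (Fin n) (DiffOp K)} (hB : Nondegenerate B)
    {M N : Matrix (Fin n) (Fin n) (DiffOp K)} (h : M * B = N * B) : M = N := by
  refine toRat_injective (hB.isUnit_toRat.mul_left_injective ?_)
  simp only [← toRat_mul, h]

/-- A left inverse is also a right inverse: `(B S) B = B (S B) = B`, and `B` can be cancelled. -/
lemma Nondegenerate.isUnit_of_mul_eq_one {B S : Matrix (Fin n) (Fin n) (DiffOp K)}
    (hB : Nondegenerate B) (h : S * B = 1) : IsUnit B :=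
  ⟨⟨B, S, hB.mul_left_cancel (by rw [mul_assoc, h, mul_one, one_mul]), h⟩, rfl⟩

/-- The dictionary between right divisibility of matrices and membership in the row module: `B` is a
right factor exactly when all rows are left combinations of the rows of `B`. -/
lemma mul_row {m l k : Type*} [Fintype l] (A : Matrix m l (DiffOp K)) (B : Matrix l k (DiffOp K))
    (i : m) : (A * B) i = ∑ j, A i j • B j := by
  funext j
  simp [Matrix.mul_apply, Finset.sum_apply]

lemma Nondegenerate.isUnit_of_span_eq_top {B : Matrix (Fin n) (Fin n) (DiffOp K)}
    (hB : Nondegenerate B) (h : Submodule.span (DiffOp K) (Set.range B) = ⊤) : IsUnit B := by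
  have h1 : ∀ i, ∃ c : Fin n → DiffOp K, ∑ j, c j • B j =
      (1 : Matrix (Fin n) (Fin n) (DiffOp K)) i := fun i =>
    (Submodule.mem_span_range_iff_exists_fun _).mp (h ▸ Submodule.mem_top)
  choose S hS using h1
  exact hB.isUnit_of_mul_eq_one (S := Matrix.of S)
    (funext fun i => (mul_row _ _ i).trans (hS i))

lemma leadingTerm_eq {P : DiffOp K} (hP : P ≠ 0) :
    ∃ u : Kˣ, leadingTerm (P : PseudoDiffOp K) =
      (((u, Multiplicative.ofAdd ((size P : ℤ) - 1)) : Kˣ × Multiplicative ℤ) :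
        WithZero (Kˣ × Multiplicative ℤ)) := by
  have hP' : (P : PseudoDiffOp K) ≠ 0 := fun h => hP (Subtype.ext h)
  obtain ⟨d, hd⟩ := Nat.exists_eq_succ_of_ne_zero (fun h => hP (size_eq_zero.mp h))
  have ho : (P : PseudoDiffOp K).order = (size P : ℤ) - 1 := by
    refine order_eq ?_ fun m hm => coeff_eq_zero_of_size_le (by omega)
    rw [hd]
    simpa using coeff_ne_zero_of_size hd
  refine ⟨Units.mk0 _ (leadingCoeff_ne_zero hP'), ?_⟩
  rw [← ho]
  exact dif_neg hP'

lemma degree_triangular {T : Matrix (Fin n) (Fin n) (DiffOp K)} (hT : ∀ i j, j < i → T i j = 0)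
    (hn : Nondegenerate T) :
    (∀ i, T i i ≠ 0) ∧ degree T = ∑ i, ((size (T i i) : ℤ) - 1) := by
  have hdet : det T = ∏ i, leadingTerm (T i i : PseudoDiffOp K) :=
    dieudonneDet_triangular _ fun i j hij => by simp [hT i j hij]
  have h0 : ∀ i, T i i ≠ 0 := by
    intro i hi
    refine hn (hdet.trans (Finset.prod_eq_zero (Finset.mem_univ i) ?_))
    rw [hi]; exact map_zero _
  refine ⟨h0, ?_⟩
  choose u hu using fun i => leadingTerm_eq (h0 i)
  simp only [hu] at hdet
  -- `degree` reads off a group element, so the coercion to the group with zero is pulled out of the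
  -- product.
  have hp : ∀ (s : Finset (Fin n)) (g : Fin n → Kˣ × Multiplicative ℤ),
      ∏ i ∈ s, (g i : WithZero (Kˣ × Multiplicative ℤ)) =
        ((∏ i ∈ s, g i : Kˣ × Multiplicative ℤ) : WithZero (Kˣ × Multiplicative ℤ)) :=
    fun s g => (map_prod (WithZero.coeMonoidHom (α := Kˣ × Multiplicative ℤ)) g s).symm
  rw [hp] at hdet
  rw [degree_eq hdet, Prod.snd_prod, toAdd_prod]
  rfl

/-- Back substitution: row `i` expresses the `i`-th basis vector through the later ones, as its
diagonal entry is a unit. The induction bounds `n - i`, starting from the vacuous case `n - i ≤ 0`.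
-/
lemma span_eq_top_of_triangular {T : Matrix (Fin n) (Fin n) (DiffOp K)}
    (hT : ∀ i j, j < i → T i j = 0) (hu : ∀ i, IsUnit (T i i)) :
    Submodule.span (DiffOp K) (Set.range T) = ⊤ := by
  have key : ∀ k : ℕ, ∀ i : Fin n, n - i ≤ k →
      (Pi.single i 1 : Fin n → DiffOp K) ∈ Submodule.span (DiffOp K) (Set.range T) := by
    intro k
    induction k with
    | zero => intro i hi; omega
    | succ k ih =>
      intro i hi
      obtain ⟨v, hv⟩ := hu i
      have hrow : T i = ∑ j, T i j • (Pi.single j 1 : Fin n → DiffOp K) :=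
        pi_eq_sum_univ' _
      rw [← Finset.add_sum_erase _ _ (Finset.mem_univ i), ← sub_eq_iff_eq_add] at hrow
      have h1 : (Pi.single i 1 : Fin n → DiffOp K) = (↑v⁻¹ : DiffOp K) •
          (T i - ∑ j ∈ Finset.univ.erase i, T i j • (Pi.single j 1 : Fin n → DiffOp K)) := by
        rw [hrow, ← hv, smul_smul, Units.inv_mul, one_smul]
      rw [h1]
      refine Submodule.smul_mem _ _ (Submodule.sub_mem _ (Submodule.subset_span ⟨i, rfl⟩)
        (Submodule.sum_mem _ fun j hj => ?_))
      rcases lt_or_gt_of_ne (Finset.ne_of_mem_erase hj) with h | h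
      · rw [hT i j h, zero_smul]; exact Submodule.zero_mem _
      · exact Submodule.smul_mem _ _ (ih j (by have := Fin.lt_def.mp h; omega))
  rw [eq_top_iff]
  intro v _
  rw [pi_eq_sum_univ' v]
  exact Submodule.sum_mem _ fun j _ => Submodule.smul_mem _ _ (key _ j le_rfl)

/-- The degree of a non-degenerate matrix differential operator is nonnegative, and it vanishes
only for invertible ones. -/
lemma degree_nonneg_and_isUnit {M : Matrix (Fin n) (Fin n) (DiffOp K)} (hM : Nondegenerate M) :
    0 ≤ degree M ∧ (degree M ≤ 0 → IsUnit M) := by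
  -- Invertibility is replaced by the rows spanning `K[∂]ⁿ`, a condition easy to carry through row
  -- additions.
  suffices h : ∀ M : Matrix (Fin n) (Fin n) (DiffOp K), Nondegenerate M →
      0 ≤ degree M ∧ (degree M ≤ 0 → Submodule.span (DiffOp K) (Set.range M) = ⊤) from
    ⟨(h M hM).1, fun h0 => hM.isUnit_of_span_eq_top ((h M hM).2 h0)⟩
  refine row_reduction _ ?_ ?_
  · intro T hT hn
    obtain ⟨h0, hdeg⟩ := degree_triangular hT hn
    have hs : ∀ i ∈ Finset.univ, 0 ≤ (size (T i i) : ℤ) - 1 := by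
      intro i _
      have := mt size_eq_zero.mp (h0 i)
      omega
    rw [hdeg]
    refine ⟨Finset.sum_nonneg hs, fun hle => span_eq_top_of_triangular hT fun i => ?_⟩
    have := (Finset.sum_eq_zero_iff_of_nonneg hs).mp (le_antisymm hle (Finset.sum_nonneg hs)) i
      (Finset.mem_univ i)
    exact isUnit_of_size_eq_one (by omega)
  · intro M i j hij a h hn
    have hdet := det_updateRow_add M hij a
    have hdeg : degree (updateRow M i (M i + a • M j)) = degree M := by
      obtain ⟨x, hx⟩ := WithZero.ne_zero_iff_exists.mp hn
      rw [degree_eq hx.symm, degree_eq (hdet.trans hx.symm)]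
    have h' := h (by rw [Nondegenerate, hdet]; exact hn)
    rw [hdeg] at h'
    -- Only one inclusion is needed: the rows of the modified matrix lie in the span of the original
    -- ones.
    refine ⟨h'.1, fun h0 => eq_top_iff.mpr ((h'.2 h0).symm.le.trans (Submodule.span_le.mpr ?_))⟩
    rintro _ ⟨k, rfl⟩
    have hmem : ∀ k, M k ∈ Submodule.span (DiffOp K) (Set.range M) :=
      fun k => Submodule.subset_span ⟨k, rfl⟩
    by_cases hk : k = i
    · subst hk
      rw [updateRow_self]
      exact Submodule.add_mem _ (hmem _) (Submodule.smul_mem _ _ (hmem _))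
    · rw [updateRow_ne hk]
      exact hmem k

/-! ### Generators of submodules and greatest common right divisors. -/

/-- Every submodule of `K[∂]ⁿ` is generated by `n` elements. -/
lemma exists_generators : ∀ {n : ℕ} (N : Submodule (DiffOp K) (Fin n → DiffOp K)),
    ∃ D : Fin n → Fin n → DiffOp K, (∀ i, D i ∈ N) ∧ ∀ v ∈ N, ∃ c : Fin n → DiffOp K,
      v = ∑ i, c i • D i := by
  intro n
  induction n with
  | zero => exact fun N => ⟨fun i => i.elim0, fun i => i.elim0,
      fun v _ => ⟨fun i => i.elim0, Subsingleton.elim _ _⟩⟩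
  | succ n ih =>
    intro N
    let ι : (Fin n → DiffOp K) →ₗ[DiffOp K] (Fin (n + 1) → DiffOp K) :=
      { toFun := fun v => Fin.cons 0 v
        map_add' := fun v w => by funext k; refine Fin.cases ?_ (fun k => ?_) k <;> simp
        map_smul' := fun a v => by funext k; refine Fin.cases ?_ (fun k => ?_) k <;> simp }
    obtain ⟨D, hD, hgen⟩ := ih (N.comap ι)
    -- The first coordinates of `N` form a left ideal with generator `x 0`. Subtracting a multiple
    -- of `x` moves any element of `N` into the part with first coordinate zero, which is a
    -- submodule of `K[∂]ⁿ`. No independence is claimed, and generators may be zero.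
    obtain ⟨_, ⟨x, hx, rfl⟩, hdiv⟩ := exists_generator (N.map (LinearMap.proj 0))
    refine ⟨Fin.cons x fun i => ι (D i), Fin.cases hx hD, fun v hv => ?_⟩
    obtain ⟨q, hq⟩ := hdiv _ ⟨v, hv, rfl⟩
    have hq' : v 0 = q * x 0 := hq
    have hι : ι (fun k => (v - q • x) k.succ) = v - q • x := by
      funext k
      refine Fin.cases ?_ (fun k => ?_) k
      · simp [ι, hq']
      · simp [ι]
    obtain ⟨c, hc⟩ := hgen (fun k => (v - q • x) k.succ)
      (by rw [Submodule.mem_comap, hι]; exact N.sub_mem hv (N.smul_mem q hx))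
    refine ⟨Fin.cons q c, ?_⟩
    rw [Fin.sum_univ_succ]
    simp only [Fin.cons_zero, Fin.cons_succ]
    rw [← sub_eq_iff_eq_add', ← hι, hc, map_sum]
    simp only [map_smul]

/-- A greatest common right divisor of two matrix differential operators. -/
lemma exists_gcd (A B : Matrix (Fin n) (Fin n) (DiffOp K)) :
    ∃ D A₁ B₁ X Y : Matrix (Fin n) (Fin n) (DiffOp K),
      A = A₁ * D ∧ B = B₁ * D ∧ D = X * A + Y * B := by
  -- The `2n` rows of `A` and `B` span a module with `n` generators, which become the rows of a
  -- square `D`. Rows of `A` and `B` in terms of `D` give `A₁`, `B₁`; rows of `D` in terms of theirs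
  -- give `X`, `Y`.
  obtain ⟨D, hD, hgen⟩ := exists_generators
    (Submodule.span (DiffOp K) (Set.range (Sum.elim (A : Fin n → _) (B : Fin n → _))))
  choose A₁ hA using fun i => hgen (A i) (Submodule.subset_span ⟨Sum.inl i, rfl⟩)
  choose B₁ hB using fun i => hgen (B i) (Submodule.subset_span ⟨Sum.inr i, rfl⟩)
  choose Z hZ using fun i => (Submodule.mem_span_range_iff_exists_fun _).mp (hD i)
  refine ⟨of D, of A₁, of B₁, of fun i j => Z i (Sum.inl j), of fun i j => Z i (Sum.inr j),
    funext fun i => (hA i).trans (mul_row _ _ i).symm,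
    funext fun i => (hB i).trans (mul_row _ _ i).symm, funext fun i => ?_⟩
  refine (hZ i).symm.trans ((Fintype.sum_sum_type _).trans ?_)
  exact (congrArg₂ (· + ·) (mul_row (of fun i j => Z i (Sum.inl j)) A i)
    (mul_row (of fun i j => Z i (Sum.inr j)) B i)).symm

/-! ### Common solutions, kernels and the Bézout identity. -/

/-- Over a linearly closed field, a proper submodule of `K[∂]ⁿ` has a nonzero common solution. -/
lemma exists_common_solution (hK : LinearlyClosed K)
    (N : Submodule (DiffOp K) (Fin n → DiffOp K)) (hN : N ≠ ⊤) :
    ∃ f : Fin n → K, f ≠ 0 ∧ ∀ v ∈ N, ∑ j, eval (v j) (f j) = 0 := by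
  -- Solutions for a larger module are solutions for `N`, so `N` may be replaced by a maximal
  -- submodule `M`; the quotient is then simple.
  obtain ⟨M, hM, hNM⟩ := (eq_top_or_exists_le_coatom N).resolve_left hN
  obtain ⟨j, hj⟩ : ∃ j, (Pi.single j 1 : Fin n → DiffOp K) ∉ M := by
    by_contra hc
    push Not at hc
    refine hM.1 (eq_top_iff.mpr fun v _ => ?_)
    rw [pi_eq_sum_univ' v]
    exact Submodule.sum_mem _ fun j _ => Submodule.smul_mem _ _ (hc j)
  obtain ⟨e, he⟩ : ∃ e : Fin n → DiffOp K, e = Pi.single j 1 := ⟨_, rfl⟩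
  rw [← he] at hj
  -- `K[∂]p` is the annihilator of the class of the basis vector `e` modulo `M`; since `e ∉ M`, the
  -- operator `p` is not a unit.
  obtain ⟨p, hp, hgen⟩ := exists_generator (M.comap (LinearMap.toSpanSingleton _ _ e))
  have hpM : p • e ∈ M := hp
  have hpu : ¬ IsUnit p := by
    rintro ⟨u, rfl⟩
    refine hj ?_
    have := M.smul_mem (↑u⁻¹ : DiffOp K) hpM
    rwa [smul_smul, Units.inv_mul, one_smul] at this
  obtain ⟨u, hu, hpu0⟩ := exists_eval_eq_zero hK hpu
  -- This makes `r • e ↦ r(u)` well defined on the quotient by `M`.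
  have hann : ∀ r : DiffOp K, r • e ∈ M → eval r u = 0 := by
    intro r hr
    obtain ⟨q, rfl⟩ := hgen r hr
    rw [eval_mul, hpu0, eval_zero_right]
  have hsup : M ⊔ Submodule.span (DiffOp K) {e} = ⊤ := hM.2 _ (left_lt_sup.mpr fun h =>
    hj (h (Submodule.mem_span_singleton_self e)))
  have hdec : ∀ i : Fin n, ∃ c : DiffOp K, (Pi.single i 1 : Fin n → DiffOp K) - c • e ∈ M := by
    intro i
    obtain ⟨m, hm, w, hw, h⟩ := Submodule.mem_sup.mp
      (hsup ▸ Submodule.mem_top : (Pi.single i 1 : Fin n → DiffOp K) ∈ _)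
    obtain ⟨c, rfl⟩ := Submodule.mem_span_singleton.mp hw
    exact ⟨c, by rwa [← h, add_sub_cancel_right]⟩
  choose c hc using hdec
  -- Modulo `M` the `i`-th basis vector is `c i • e`, so `f i` is its image under that map. In
  -- particular `f j = u`, because `(1 - c j) • e ∈ M`; hence `f ≠ 0`.
  refine ⟨fun i => eval (c i) u, fun h0 => hu ?_, fun v hv => ?_⟩
  · have h1 := hc j
    rw [← he] at h1
    have h2 := hann (1 - c j) (by rwa [sub_smul, one_smul])
    have h3 := eval_add (1 - c j) (c j) u
    rw [sub_add_cancel, eval_one, h2, zero_add] at h3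
    rw [h3]
    exact congrFun h0 j
  · simp only [← eval_mul]
    rw [← eval_sum]
    refine hann _ ?_
    -- This sum is `v - (∑ v i * c i) • e`. As `v` lies in `M`, so does `(∑ v i * c i) • e`, and
    -- `hann` applies.
    have h1 : ∑ i, v i • ((Pi.single i 1 : Fin n → DiffOp K) - c i • e) ∈ M :=
      Submodule.sum_mem _ fun i _ => Submodule.smul_mem _ _ (hc i)
    simp only [smul_sub, Finset.sum_sub_distrib, smul_smul] at h1
    rw [← pi_eq_sum_univ' v, ← Finset.sum_smul] at h1
    exact (M.sub_mem_iff_right (hNM hv)).mp h1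

lemma zero_mem_ker (A : Matrix (Fin n) (Fin n) (DiffOp K)) : (0 : Fin n → K) ∈ ker A :=
  fun _ => Finset.sum_eq_zero fun _ _ => eval_zero_right _

/-- If the rows of `D` failed to span `K[∂]ⁿ`, their common nonzero solution would be a nonzero
element of `ker D`. -/
lemma isUnit_of_ker (hK : LinearlyClosed K) {D : Matrix (Fin n) (Fin n) (DiffOp K)}
    (hD : Nondegenerate D) (hker : ker D ⊆ {0}) : IsUnit D := by
  refine hD.isUnit_of_span_eq_top (by_contra fun hN => ?_)
  obtain ⟨f, hf, hf0⟩ := exists_common_solution hK _ hN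
  exact hf (hker fun i => hf0 _ (Submodule.subset_span ⟨i, rfl⟩))

lemma ker_subset_ker_mul (A D : Matrix (Fin n) (Fin n) (DiffOp K)) : ker D ⊆ ker (A * D) := by
  intro f hf i
  simp only [Matrix.mul_apply, eval_sum, eval_mul]
  rw [Finset.sum_comm]
  refine Finset.sum_eq_zero fun k _ => ?_
  rw [← eval_sum_right, hf k, eval_zero_right]

lemma mem_ker_add {A B : Matrix (Fin n) (Fin n) (DiffOp K)} {f : Fin n → K} (hA : f ∈ ker A)
    (hB : f ∈ ker B) : f ∈ ker (A + B) := by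
  intro i
  simp only [Matrix.add_apply, eval_add, Finset.sum_add_distrib]
  rw [hA i, hB i, add_zero]

lemma eq_zero_of_mem_ker_one {f : Fin n → K}
    (hf : f ∈ ker (1 : Matrix (Fin n) (Fin n) (DiffOp K))) : f = 0 := by
  funext i
  have := hf i
  rw [Finset.sum_eq_single i, Matrix.one_apply_eq, eval_one] at this
  · exact this
  · intro j _ hj
    rw [Matrix.one_apply_ne hj.symm, eval_zero]
  · simp

/-- A Bézout identity implies that the kernels intersect trivially. -/
lemma ker_inter_ker_eq {A B X Y : Matrix (Fin n) (Fin n) (DiffOp K)} (h : X * A + Y * B = 1) :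
    ker A ∩ ker B = {0} := by
  refine Set.Subset.antisymm (fun f hf => ?_) ?_
  · refine eq_zero_of_mem_ker_one (K := K) ?_
    rw [← h]
    exact mem_ker_add (ker_subset_ker_mul X A hf.1) (ker_subset_ker_mul Y B hf.2)
  · rintro _ rfl
    exact ⟨zero_mem_ker A, zero_mem_ker B⟩

/-- The greatest common right divisor is a unit by coprimality; its inverse normalizes `D = X A + Y
B` to the identity. -/
lemma Coprime.exists_bezout {A B : Matrix (Fin n) (Fin n) (DiffOp K)} (h : Coprime A B) :
    ∃ X Y, X * A + Y * B = 1 := by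
  obtain ⟨D, A₁, B₁, X, Y, hA, hB, hD⟩ := exists_gcd A B
  obtain ⟨u, rfl⟩ := h A₁ B₁ D hA hB
  refine ⟨(↑u⁻¹ : Matrix (Fin n) (Fin n) (DiffOp K)) * X, (↑u⁻¹ : Matrix _ _ _) * Y, ?_⟩
  rw [mul_assoc, mul_assoc, ← mul_add, ← hD, Units.inv_mul]

/-! ### Manipulation of fractions. -/

/-- Clearing the denominator removes `Ring.inverse`; later arguments use only the equation `H B =
A`. -/
lemma isFraction_iff {H : Matrix (Fin n) (Fin n) (RatPseudoDiffOp K)}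
    {A B : Matrix (Fin n) (Fin n) (DiffOp K)} :
    IsFraction H A B ↔ Nondegenerate B ∧ H * toRat B = toRat A := by
  refine and_congr_right fun hB => ?_
  have hu := hB.isUnit_toRat
  constructor
  · rintro rfl
    rw [mul_assoc, Ring.inverse_mul_cancel _ hu, mul_one]
  · intro h
    rw [← h, mul_assoc, Ring.mul_inverse_cancel _ hu, mul_one]

/-- A common right factor `D` inherits non-degeneracy from `B * D`, hence is invertible over `K(∂)`
and cancels. -/
lemma IsFraction.of_mul {H : Matrix (Fin n) (Fin n) (RatPseudoDiffOp K)}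
    {A B D : Matrix (Fin n) (Fin n) (DiffOp K)} (h : IsFraction H (A * D) (B * D)) :
    IsFraction H A B := by
  rw [isFraction_iff] at h ⊢
  obtain ⟨hB, hD⟩ := nondegenerate_mul.mp h.1
  refine ⟨hB, hD.isUnit_toRat.mul_left_injective ?_⟩
  have := h.2
  rw [toRat_mul, toRat_mul, ← mul_assoc] at this
  exact this

/-- The Bézout identity says that `X H + Y` is the inverse of `B` over `K(∂)`. So `B⁻¹ E = X C + Y
E` has entries in `K[∂]`, and this is the factor `D`. Both (c) and the minimality of `d(B)` come
from here. -/
lemma IsFraction.exists_of_bezout {H : Matrix (Fin n) (Fin n) (RatPseudoDiffOp K)}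
    {A B C E X Y : Matrix (Fin n) (Fin n) (DiffOp K)} (h : IsFraction H A B)
    (h' : IsFraction H C E) (hb : X * A + Y * B = 1) : ∃ D, C = A * D ∧ E = B * D := by
  rw [isFraction_iff] at h h'
  obtain ⟨hB, hA⟩ := h
  obtain ⟨-, hC⟩ := h'
  have hu := hB.isUnit_toRat
  have h1 : (toRat X * H + toRat Y) * toRat B = 1 := by
    rw [add_mul, mul_assoc, hA, ← toRat_mul, ← toRat_mul, ← toRat_add, hb, toRat_one]
  have h2 : toRat B * (toRat X * H + toRat Y) = 1 := by
    refine hu.mul_left_injective ?_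
    simp only
    rw [mul_assoc, h1, mul_one, one_mul]
  have hE : E = B * (X * C + Y * E) := by
    apply toRat_injective
    rw [toRat_mul, toRat_add, toRat_mul, toRat_mul, ← hC, ← mul_assoc (toRat X), ← add_mul,
      ← mul_assoc, h2, one_mul]
  refine ⟨X * C + Y * E, ?_, hE⟩
  apply toRat_injective
  rw [toRat_mul, ← hA, mul_assoc, ← toRat_mul, ← hE, hC]

lemma exists_isFraction (H : Matrix (Fin n) (Fin n) (RatPseudoDiffOp K)) :
    ∃ A B, IsFraction H A B := by
  obtain ⟨b, hb, h⟩ := exists_common_denominator Finset.univ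
    (fun ij : Fin n × Fin n => H ij.1 ij.2)
  choose a ha using fun i j => h (i, j) (Finset.mem_univ _)
  -- The denominator is the scalar matrix of a common right denominator of all entries,
  -- non-degenerate because `b ≠ 0`.
  refine ⟨a, Matrix.diagonal fun _ => b, isFraction_iff.mpr ⟨?_, ?_⟩⟩
  · rw [Nondegenerate, det, dieudonneDet_triangular _ fun i j hij => by
      rw [Matrix.map_apply, Matrix.diagonal_apply_ne _ hij.ne', map_zero]]
    refine Finset.prod_ne_zero_iff.mpr fun i _ => (map_ne_zero _).mpr ?_
    rw [Matrix.map_apply, Matrix.diagonal_apply_eq]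
    exact fun h0 => hb (Subtype.ext h0)
  · have hd : toRat (Matrix.diagonal fun _ : Fin n => b) =
        Matrix.diagonal fun _ => DiffOp.toRat b := Matrix.diagonal_map (map_zero _)
    rw [hd]
    funext i j
    rw [Matrix.mul_diagonal]
    exact ha i j

end MatDiffOp

/-! ### The theorem. -/

theorem proposition6p5 {K : Type*} [Field K] [CharZero K] [Differential K]
    (hK : LinearlyClosed K) (n : ℕ) :
    (∀ H : Matrix (Fin n) (Fin n) (RatPseudoDiffOp K),
      ∃ A B : Matrix (Fin n) (Fin n) (DiffOp K),
        MatDiffOp.IsFraction H A B ∧ MatDiffOp.ker A ∩ MatDiffOp.ker B = {0}) ∧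
    (∀ (H : Matrix (Fin n) (Fin n) (RatPseudoDiffOp K))
      (A B : Matrix (Fin n) (Fin n) (DiffOp K)), MatDiffOp.IsFraction H A B →
        [MatDiffOp.IsMinimalFraction H A B,
          MatDiffOp.Coprime A B,
          MatDiffOp.ker A ∩ MatDiffOp.ker B = {0}].TFAE) ∧
    (∀ (H : Matrix (Fin n) (Fin n) (RatPseudoDiffOp K))
      (A₀ B₀ A B : Matrix (Fin n) (Fin n) (DiffOp K)),
        MatDiffOp.IsMinimalFraction H A₀ B₀ → MatDiffOp.IsFraction H A B →
          ∃ D : Matrix (Fin n) (Fin n) (DiffOp K), A = A₀ * D ∧ B = B₀ * D) := by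
  have hker : ∀ {A B : Matrix (Fin n) (Fin n) (DiffOp K)}, MatDiffOp.Nondegenerate B →
      MatDiffOp.ker A ∩ MatDiffOp.ker B = {0} → MatDiffOp.Coprime A B := by
    intro A B hB h A₁ B₁ D hA hB'
    rw [hB'] at hB
    -- `ker D` lies in both kernels, and `D` is non-degenerate as a factor of `B`.
    refine MatDiffOp.isUnit_of_ker hK (MatDiffOp.nondegenerate_mul.mp hB).2 fun f hf => ?_
    rw [← h, hA, hB']
    exact ⟨MatDiffOp.ker_subset_ker_mul _ _ hf, MatDiffOp.ker_subset_ker_mul _ _ hf⟩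
  have hmin : ∀ {H : Matrix (Fin n) (Fin n) (RatPseudoDiffOp K)}
      {A B : Matrix (Fin n) (Fin n) (DiffOp K)},
      MatDiffOp.IsMinimalFraction H A B → MatDiffOp.Coprime A B := by
    rintro H A B ⟨h, hle⟩ A₁ B₁ D rfl rfl
    obtain ⟨hB, hD⟩ := MatDiffOp.nondegenerate_mul.mp h.1
    -- Removing `D` leaves a fraction with denominator of degree `d(B) - d(D)`, so minimality forces
    -- `d(D) ≤ 0`.
    have h1 := hle A₁ B₁ h.of_mul
    rw [MatDiffOp.degree_mul hB hD] at h1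
    exact (MatDiffOp.degree_nonneg_and_isUnit hD).2 (by omega)
  refine ⟨fun H => ?_, fun H A B h => ?_, fun H A₀ B₀ A B h₀ h => ?_⟩
  · obtain ⟨A, B, h⟩ := MatDiffOp.exists_isFraction H
    obtain ⟨D, A₁, B₁, X, Y, rfl, rfl, hD⟩ := MatDiffOp.exists_gcd A B
    refine ⟨A₁, B₁, h.of_mul, MatDiffOp.ker_inter_ker_eq (X := X) (Y := Y) ?_⟩
    -- `D = X A + Y B` becomes `(X A₁ + Y B₁) D = D`; cancelling the non-degenerate `D` gives the
    -- Bézout identity for `A₁` and `B₁`.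
    refine (MatDiffOp.nondegenerate_mul.mp h.1).2.mul_left_cancel ?_
    rw [add_mul, mul_assoc, mul_assoc, ← hD, one_mul]
  · tfae_have 1 → 2 := hmin
    tfae_have 2 → 3 := fun hc => by
      obtain ⟨X, Y, hb⟩ := hc.exists_bezout
      exact MatDiffOp.ker_inter_ker_eq hb
    tfae_have 3 → 2 := hker h.1
    tfae_have 2 → 1 := fun hc => by
      obtain ⟨X, Y, hb⟩ := hc.exists_bezout
      refine ⟨h, fun C E h' => ?_⟩
      -- Any competing denominator is `B * D`, of degree `d(B) + d(D) ≥ d(B)`.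
      obtain ⟨D, -, rfl⟩ := h.exists_of_bezout h' hb
      obtain ⟨hB, hD⟩ := MatDiffOp.nondegenerate_mul.mp h'.1
      have := (MatDiffOp.degree_nonneg_and_isUnit hD).1
      rw [MatDiffOp.degree_mul hB hD]
      omega
    tfae_finish
  · obtain ⟨X, Y, hb⟩ := (hmin h₀).exists_bezout
    exact h₀.1.exists_of_bezout h hb
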